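/- Let $G$ be a finite graph (loops and multiple edges allowed) with vertex set $V(G)$ and edge set $E(G)$, having at least $3$ vertices and at least one edge (for instance, any connected graph with at least $3$ vertices). Let $$\Psi_G=\sum_{T}\ \prod_{e\notin T}x_e\ \in\ \mathbb Z[x_e : e\in E(G)],$$ where $T$ runs over the spanning trees of $G$ (so $\Psi_G=0$ if $G$ is disconnected). Let $X_G=V(\Psi_G)\subset\mathbb A^{E(G)}$ be the affine graph hypersurface, and let $$\mathrm{Sing}(X_G)=V\bigl(\Psi_G,\ \partial\Psi_G/\partial x_e : e\in E(G)\bigr)\subset \mathbb A^{E(G)}.$$ For a field $k$, let $K_0(\mathrm{Var}_k)$ be the Grothendieck ring of varieties over $k$: it is generated by the isomorphism classes $[X]$ of separated $k$-schemes of finite type, subject to the relations $[X]=[Z]+[X\setminus Z]$ for $Z\subset X$ closed, with product $[X][Y]=[X\times_k Y]$ and unit $[\mathrm{Spec}\,k]$. Put $\mathbb L=[\mathbb A^1_k]$. Then for every field $k$, $$[\mathrm{Sing}(X_G)]\equiv 0 \bmod \mathbb L\quad\text{in } K_0(\mathrm{Var}_k),$$ that is, $[\mathrm{Sing}(X_G)]$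 lies in the ideal generated by $\mathbb L$. Moreover, for every prime power $q$, the number $[\mathrm{Sing}(X_G)]_q$ of points of $\mathrm{Sing}(X_G)$ over the field $\mathbb F_q$ satisfies $[\mathrm{Sing}(X_G)]_q\equiv 0 \bmod q$. -/

import Mathlib

open CategoryTheory AlgebraicGeometry

universe u v w

noncomputable section

/-! ### Graph polynomials

Graphs are Mathlib's `Graph α β`: loops and multiple edges are allowed. -/

/-- `T` is (the edge set of) a spanning tree of `G`: the graph on all the vertices of `G` with the
edges in `T` is non-empty, connected, and has no cycles (no edge of `T` has its two ends joined by a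
path in the remaining edges of `T`; in particular `T` contains no loop). -/
structure Graph.IsSpanningTree {α β : Type*} (G : Graph α β) (T : Set β) : Prop where
  subset : T ⊆ G.edgeSet
  nonempty : G.vertexSet.Nonempty
  connected : ∀ x ∈ G.vertexSet, ∀ y ∈ G.vertexSet,
    Relation.ReflTransGen (fun a b => ∃ e ∈ T, G.IsLink e a b) x y
  acyclic : ∀ e ∈ T, ∀ x y, G.IsLink e x y →
    ¬ Relation.ReflTransGen (fun a b => ∃ f ∈ T \ {e}, G.IsLink f a b) x y

open Classical in
/-- The graph polynomial `Ψ_G = ∑_T ∏_{e ∉ T} x_e`, over all spanning trees `T` of `G`, with integer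
coefficients and one variable for every edge of `G`. It is zero if `G` is disconnected. -/
def Graph.psi {α β : Type*} (G : Graph α β) [Fintype G.edgeSet] : MvPolynomial G.edgeSet ℤ :=
  ∑ T : Set G.edgeSet with G.IsSpanningTree (Subtype.val '' T),
    ∏ e : G.edgeSet with e ∉ T, MvPolynomial.X e

/-- The equations of the singular locus of the affine graph hypersurface: the graph polynomial and
all its first partial derivatives. -/
def Graph.singEqs {α β : Type*} (G : Graph α β) [Fintype G.edgeSet] :
    Set (MvPolynomial G.edgeSet ℤ) :=
  {G.psi} ∪ Set.range fun e : G.edgeSet => MvPolynomial.pderiv e G.psi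

/-! ### The Grothendieck ring of varieties -/

/-- A `k`-variety is a separated scheme of finite type over `Spec k`. -/
structure IsVar (k : Type u) [Field k] (X : Over (Spec (CommRingCat.of k))) : Prop where
  locallyOfFiniteType : LocallyOfFiniteType X.hom
  quasiCompact : QuasiCompact X.hom
  isSeparated : IsSeparated X.hom

/-- The type of `k`-varieties. -/
def VarOver (k : Type u) [Field k] : Type (u + 1) :=
  {X : Over (Spec (CommRingCat.of k)) // IsVar k X}

/-- The affine `k`-variety `Spec A` of a finitely generated `k`-algebra `A`. -/
def VarOver.spec (k : Type u) [Field k] (A : Type u) [CommRing A] [Algebra k A]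
    [Algebra.FiniteType k A] : VarOver k :=
  ⟨Over.mk (Spec.map (CommRingCat.ofHom (algebraMap k A))),
    { locallyOfFiniteType := by
        change LocallyOfFiniteType (Spec.map (CommRingCat.ofHom (algebraMap k A)))
        rw [HasRingHomProperty.Spec_iff (P := @LocallyOfFiniteType)]
        exact RingHom.finiteType_algebraMap.mpr inferInstance
      quasiCompact := by
        change QuasiCompact (Spec.map (CommRingCat.ofHom (algebraMap k A)))
        infer_instance
      isSeparated := by
        change IsSeparated (Spec.map (CommRingCat.ofHom (algebraMap k A)))
        infer_instance }⟩

/-- The defining relations of the Grothendieck ring: the elements of the free commutative ring on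
all `k`-varieties that are to become zero. -/
inductive K0Rel (k : Type u) [Field k] : FreeCommRing (VarOver k) → Prop
  /-- Isomorphic varieties have the same class. -/
  | iso (X Y : VarOver k) (f : X.1 ≅ Y.1) : K0Rel k (FreeCommRing.of X - FreeCommRing.of Y)
  /-- `[X] = [Z] + [X ∖ Z]` for a closed subvariety `Z` of `X`; `U` is its open complement. -/
  | scissor (X Z U : VarOver k) (i : Z.1 ⟶ X.1) (j : U.1 ⟶ X.1)
      (hi : IsClosedImmersion i.left) (hj : IsOpenImmersion j.left)
      (h : Set.range j.left = (Set.range i.left)ᶜ) :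
      K0Rel k (FreeCommRing.of X - (FreeCommRing.of Z + FreeCommRing.of U))
  /-- `[X ×ₖ Y] = [X] * [Y]`; `P` is the fibre product. -/
  | prod (X Y P : VarOver k) (p : P.1 ⟶ X.1) (q : P.1 ⟶ Y.1)
      (h : IsPullback p.left q.left X.1.hom Y.1.hom) :
      K0Rel k (FreeCommRing.of P - FreeCommRing.of X * FreeCommRing.of Y)
  /-- The class of the point `Spec k` is `1`. -/
  | point : K0Rel k (FreeCommRing.of (VarOver.spec k k) - 1)

/-- The Grothendieck ring `K₀(Var_k)`. -/
abbrev K0Var (k : Type u) [Field k] : Type (u + 1) :=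
  FreeCommRing (VarOver k) ⧸ Ideal.span {r | K0Rel k r}

/-- The class `[X]` of a `k`-variety `X` in `K₀(Var_k)`. -/
def VarOver.toK0 {k : Type u} [Field k] (X : VarOver k) : K0Var k :=
  Ideal.Quotient.mk _ (FreeCommRing.of X)

/-- The Lefschetz class, i.e. the class of the affine line `Spec k[t]`. -/
def lefschetz (k : Type u) [Field k] : K0Var k :=
  (VarOver.spec k (Polynomial k)).toK0

/-! ### Zero loci of integral polynomials -/

/-- The closed subscheme `V(S)` of the affine space over `k` with coordinates indexed by `σ`, cut out
by the images in `k[x_i, i ∈ σ]` of a set `S` of integral polynomials. -/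
def zeroScheme {σ : Type} [Finite σ] (S : Set (MvPolynomial σ ℤ)) (k : Type u) [Field k] :
    VarOver k :=
  VarOver.spec k
    (MvPolynomial σ k ⧸ Ideal.span (MvPolynomial.map (Int.castRingHom k) '' S))

/-- The number of points over `F` of the zero locus of a set `S` of integral polynomials. -/
def pointCount {σ : Type v} (S : Set (MvPolynomial σ ℤ)) (F : Type w) [Field F] : ℕ :=
  Nat.card {x : σ → F // ∀ f ∈ S, MvPolynomial.aeval x f = 0}

end

/-! Both assertions hold for every invariant of affine varieties that is additive under cutting
along `f = 0` and kills every `A[t]` (`AffineInvariant`). The class modulo the Lefschetz class and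
the number of points modulo `q` are two instances. Such an invariant depends only on points over
field extensions (`locus_congr`), so equations may be replaced by any others with the same
field-valued zeros.

The engine is the elimination of a variable `t` from a system `a_i t + b_i = 0` (`zeros_succ`).
Where some `a_i ≠ 0`, `t` is determined and the condition on the other variables is `a_i b_j = a_j
b_i`. Where all `a_i` vanish, the solutions form a cylinder, of value `0`. Hence the value of the
system is that of the locus of the minors minus that of the locus `a = 0`.

For a graph with a spanning tree, let `B` be the incidence matrix without the column of a root, and
`N` the symmetric matrix with blocks `diagonal x`, `B`, `Bᵀ`, `0`. By the matrix-tree theorem `det N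
= ± Ψ`, and its principal minors at the edges are `± ∂Ψ/∂x_e`. A kernel argument then gives `Sing =
{adj N = 0}`, the locus of corank at least two.

Eliminating the edge variables one by one shows that this locus has the value of the whole affine
space `𝔸^m`. Three inductions on `m` are nested. The minors of the system `adj = 0` cut out `det =
bordered det = 0` (`adjugate_bordered_proportional_iff`). The minor of that pair is, up to sign and
modulo the smaller pair's Desnanot-Jacobi identity, the square of one bordered determinant. A single
linear equation has no minors. In each case the two terms of the elimination both have the value of
`𝔸^m` and cancel. The inductions start because three vertices make the zero block of size at least
two, with zero adjugate. Finally `𝔸^m` has value `0` for `m ≥ 1`, which also settles the case `Ψ =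
0`. -/

/-! ### Additive invariants of affine varieties -/

/-- An additive invariant of affine varieties over `k` that does not see nilpotents and kills every
product with the affine line. -/
structure AffineInvariant (k : Type u) [Field k] (Q : Type w) [AddCommGroup Q] where
  /-- The value of the invariant on `Spec A`. -/
  cls : ∀ (A : Type u) [CommRing A] [Algebra k A] [Algebra.FiniteType k A], Q
  congr : ∀ (A B : Type u) [CommRing A] [Algebra k A] [Algebra.FiniteType k A]
    [CommRing B] [Algebra k B] [Algebra.FiniteType k B], (A ≃ₐ[k] B) → cls A = cls B
  scissor : ∀ (A : Type u) [CommRing A] [Algebra k A] [Algebra.FiniteType k A] (I : Ideal A)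
    (f : A), PrimeSpectrum.zeroLocus (I : Set A) = PrimeSpectrum.zeroLocus {f} →
    cls A = cls (A ⧸ I) + cls (Localization.Away f)
  polynomial : ∀ (A : Type u) [CommRing A] [Algebra k A] [Algebra.FiniteType k A],
    cls (Polynomial A) = 0

/-- `φ : A → B` represents the locally closed locus of `Spec A` where the elements of `S` vanish and
`g` is invertible. -/
structure Represents {k : Type u} [Field k] {A B : Type u} [CommRing A] [Algebra k A] [CommRing B]
    [Algebra k B] (S : Set A) (g : A) (φ : A →ₐ[k] B) : Prop where
  zero : ∀ s ∈ S, φ s = 0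
  unit : IsUnit (φ g)
  lift : ∀ (R : Type u) [CommRing R] [Algebra k R] (ψ : A →ₐ[k] R), (∀ s ∈ S, ψ s = 0) →
    IsUnit (ψ g) → ∃ χ : B →ₐ[k] R, ∀ a, χ (φ a) = ψ a
  hom_ext : ∀ (R : Type u) [CommRing R] [Algebra k R] (χ χ' : B →ₐ[k] R),
    (∀ a, χ (φ a) = χ' (φ a)) → χ = χ'

namespace Represents

variable {k : Type u} [Field k] {A B B' : Type u} [CommRing A] [Algebra k A] [CommRing B]
  [Algebra k B] [CommRing B'] [Algebra k B'] {S : Set A} {g : A} {φ : A →ₐ[k] B}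
  {φ' : A →ₐ[k] B'}

/-- Loci are described by a universal property so that iterated quotients and localizations can be
compared through what they represent. -/
theorem nonempty_equiv (h : Represents S g φ) (h' : Represents S g φ') : Nonempty (B ≃ₐ[k] B') := by
  obtain ⟨χ, hχ⟩ := h.lift B' φ' h'.zero h'.unit
  obtain ⟨χ', hχ'⟩ := h'.lift B φ h.zero h.unit
  exact ⟨AlgEquiv.ofAlgHom χ χ' (h'.hom_ext _ _ _ fun a => by simp [hχ, hχ'])
    (h.hom_ext _ _ _ fun a => by simp [hχ, hχ'])⟩

theorem quotient (h : Represents S g φ) (T : Set A) :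
    Represents (S ∪ T) g ((Ideal.Quotient.mkₐ k (Ideal.span (φ '' T))).comp φ) where
  zero s hs := by
    rcases hs with hs | hs
    · simp [h.zero s hs]
    · simpa using Ideal.Quotient.eq_zero_iff_mem.mpr
        (Ideal.subset_span (Set.mem_image_of_mem φ hs))
  unit := by simpa using h.unit.map (Ideal.Quotient.mk (Ideal.span (φ '' T)))
  lift R _ _ ψ hψ hu := by
    obtain ⟨χ, hχ⟩ := h.lift R ψ (fun s hs => hψ s (Or.inl hs)) hu
    refine ⟨Ideal.Quotient.liftₐ _ χ fun a ha => ?_, fun a => hχ a⟩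
    have : Ideal.span (φ '' T) ≤ RingHom.ker χ := by
      rw [Ideal.span_le]
      rintro _ ⟨t, ht, rfl⟩
      simp [RingHom.mem_ker, hχ, hψ t (Or.inr ht)]
    exact this ha
  hom_ext R _ _ χ χ' hh := by
    apply Ideal.Quotient.algHom_ext
    exact h.hom_ext _ _ _ fun a => by simpa using hh a

theorem away (h : Represents S g φ) (f : A) :
    Represents S (g * f) ((IsScalarTower.toAlgHom k B (Localization.Away (φ f))).comp φ) where
  zero s hs := by simp [h.zero s hs]
  unit := by
    simp only [AlgHom.comp_apply, map_mul, IsScalarTower.coe_toAlgHom']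
    exact (h.unit.map _).mul (IsLocalization.Away.algebraMap_isUnit _)
  lift R _ _ ψ hψ hu := by
    rw [map_mul] at hu
    obtain ⟨χ, hχ⟩ := h.lift R ψ hψ (isUnit_of_mul_isUnit_left hu)
    have hf : IsUnit (χ (φ f)) := by rw [hχ]; exact isUnit_of_mul_isUnit_right hu
    refine ⟨IsLocalization.liftAlgHom (M := Submonoid.powers (φ f)) (f := χ) ?_, fun a => ?_⟩
    · rintro ⟨_, n, rfl⟩
      simpa using hf.pow n
    · simpa using hχ a
  hom_ext R _ _ χ χ' hh := by
    apply IsLocalization.algHom_ext (Submonoid.powers (φ f))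
    exact h.hom_ext _ _ _ fun a => hh a

/-- Where `a` is invertible, `a t + b = 0` has the single solution `t = -b/a`. The locus is the
graph of a function, so the same ring `B` represents it. -/
theorem graph {a : A} (b : A) (h : Represents S (a * g) φ) :
    ∃ φ' : Polynomial A →ₐ[k] B, Represents
      (Polynomial.C '' S ∪ {Polynomial.C a * Polynomial.X + Polynomial.C b})
      (Polynomial.C (a * g)) φ' := by
  have hu := h.unit
  rw [map_mul] at hu
  obtain ⟨c, hc⟩ := (isUnit_of_mul_isUnit_left hu).exists_right_inv
  let φ' : Polynomial A →ₐ[k] B :=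
    Polynomial.eval₂AlgHom φ (-(c * φ b)) fun _ => Commute.all _ _
  have hC : ∀ x, φ' (Polynomial.C x) = φ x := fun x => by simp [φ']
  have hX : φ' Polynomial.X = -(c * φ b) := by simp [φ']
  refine ⟨φ', ?_, ?_, ?_, ?_⟩
  · rintro s (⟨s, hs, rfl⟩ | rfl)
    · rw [hC, h.zero s hs]
    · rw [map_add, map_mul, hC, hC, hX]
      linear_combination (-φ b) * hc
  · rw [hC]; exact h.unit
  · intro R _ _ ψ hψ hu
    let ι : A →ₐ[k] Polynomial A := IsScalarTower.toAlgHom k A (Polynomial A)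
    have hι : ∀ x, ι x = Polynomial.C x := fun x => by simp [ι]
    obtain ⟨χ, hχ⟩ := h.lift R (ψ.comp ι)
      (fun s hs => by
        simpa [hι] using hψ (Polynomial.C s) (Or.inl (Set.mem_image_of_mem _ hs)))
      (by simpa [hι] using hu)
    have hχ' : ∀ x, χ (φ x) = ψ (Polynomial.C x) := fun x => by rw [hχ]; simp [hι]
    refine ⟨χ, fun p => ?_⟩
    have h1 : ψ (Polynomial.C a) * ψ Polynomial.X + ψ (Polynomial.C b) = 0 := by
      rw [← map_mul, ← map_add]
      exact hψ _ (Or.inr rfl)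
    have h2 : χ c * ψ (Polynomial.C a) = 1 := by
      rw [← hχ', ← map_mul, mul_comm, hc, map_one]
    have h3 : χ (φ' Polynomial.X) = ψ Polynomial.X := by
      rw [hX, map_neg, map_mul, hχ']
      linear_combination (-χ c) * h1 + ψ Polynomial.X * h2
    induction p using Polynomial.induction_on' with
    | add p q hp hq => simp [hp, hq]
    | monomial n x =>
      rw [← Polynomial.C_mul_X_pow_eq_monomial]
      simp only [map_mul, map_pow, hC, hχ', h3]
  · intro R _ _ χ χ' hh
    exact h.hom_ext _ _ _ fun x => by simpa [hC] using hh (Polynomial.C x)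

theorem cylinder (h : Represents S g φ) :
    Represents (Polynomial.C '' S) (Polynomial.C g) (Polynomial.mapAlgHom φ) where
  zero := by
    rintro _ ⟨s, hs, rfl⟩
    simp [h.zero s hs]
  unit := by simpa using h.unit.map Polynomial.C
  lift R _ _ ψ hψ hu := by
    let ι : A →ₐ[k] Polynomial A := IsScalarTower.toAlgHom k A (Polynomial A)
    have hι : ∀ x, ι x = Polynomial.C x := fun x => by simp [ι]
    obtain ⟨χ, hχ⟩ := h.lift R (ψ.comp ι)
      (fun s hs => by
        simpa [hι] using hψ (Polynomial.C s) (Set.mem_image_of_mem _ hs))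
      (by simpa [hι] using hu)
    let η : Polynomial B →ₐ[k] R :=
      Polynomial.eval₂AlgHom χ (ψ Polynomial.X) fun _ => Commute.all _ _
    have hC : ∀ x, η (Polynomial.C x) = χ x := fun x => by simp [η]
    have hX : η Polynomial.X = ψ Polynomial.X := by simp [η]
    refine ⟨η, fun p => ?_⟩
    induction p using Polynomial.induction_on' with
    | add p q hp hq => simp only [map_add, hp, hq]
    | monomial n x =>
      rw [← Polynomial.C_mul_X_pow_eq_monomial]
      simp [hC, hX, hχ, hι]
  hom_ext R _ _ χ χ' hh := by
    let ι : B →ₐ[k] Polynomial B := IsScalarTower.toAlgHom k B (Polynomial B)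
    have hι : ∀ x, ι x = Polynomial.C x := fun x => by simp [ι]
    have h1 : χ.comp ι = χ'.comp ι :=
      h.hom_ext _ _ _ fun a => by simpa [hι] using hh (Polynomial.C a)
    have h2 : ∀ x, χ (Polynomial.C x) = χ' (Polynomial.C x) := fun x => by
      simpa [hι] using DFunLike.congr_fun h1 x
    have h3 : χ Polynomial.X = χ' Polynomial.X := by simpa using hh Polynomial.X
    refine AlgHom.ext fun p => ?_
    induction p using Polynomial.induction_on' with
    | add p q hp hq => simp only [map_add, hp, hq]
    | monomial n x =>
      rw [← Polynomial.C_mul_X_pow_eq_monomial]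
      simp only [map_mul, map_pow, h2, h3]

theorem mk_span (S : Set A) : Represents S 1 (Ideal.Quotient.mkₐ k (Ideal.span S)) where
  zero s hs := by simpa using Ideal.Quotient.eq_zero_iff_mem.mpr (Ideal.subset_span hs)
  unit := by simp
  lift R _ _ ψ hψ _ :=
    ⟨Ideal.Quotient.liftₐ _ ψ fun a ha =>
      (Ideal.span_le.mpr hψ : Ideal.span S ≤ RingHom.ker ψ) ha, fun a => rfl⟩
  hom_ext R _ _ χ χ' hh := Ideal.Quotient.algHom_ext _ (AlgHom.ext hh)

theorem comp_equiv {A' : Type u} [CommRing A'] [Algebra k A'] (h : Represents S g φ)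
    (e : A' ≃ₐ[k] A) : Represents (e ⁻¹' S) (e.symm g) (φ.comp e.toAlgHom) where
  zero s hs := h.zero _ hs
  unit := by simpa using h.unit
  lift R _ _ ψ hψ hu := by
    obtain ⟨χ, hχ⟩ := h.lift R (ψ.comp e.symm.toAlgHom)
      (fun s hs => by simpa using hψ (e.symm s) (by simpa using hs)) (by simpa using hu)
    exact ⟨χ, fun a => by simpa using hχ (e a)⟩
  hom_ext R _ _ χ χ' hh := h.hom_ext _ _ _ fun a => by simpa using hh (e.symm a)

end Represents

theorem Represents.mul_of_isUnit {k : Type u} [Field k] {A B : Type u} [CommRing A] [Algebra k A]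
    [CommRing B] [Algebra k B] {S : Set A} {g g' : A} {φ : A →ₐ[k] B} (h : Represents S g φ)
    (hu : IsUnit (φ g')) : Represents S (g * g') φ where
  zero := h.zero
  unit := by rw [map_mul]; exact h.unit.mul hu
  lift R _ _ ψ hψ hg := h.lift R ψ hψ (isUnit_of_mul_isUnit_left (by rwa [map_mul] at hg))
  hom_ext := h.hom_ext

/-! ### Values on loci and elimination of a linear variable. -/

namespace AffineInvariant

variable {k : Type u} [Field k] {Q : Type w} [AddCommGroup Q] (c : AffineInvariant k Q)

theorem cls_eq_of_represents {A B B' : Type u} [CommRing A] [Algebra k A] [CommRing B] [Algebra k B]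
    [Algebra.FiniteType k B] [CommRing B'] [Algebra k B'] [Algebra.FiniteType k B']
    {S : Set A} {g : A} {φ : A →ₐ[k] B} {φ' : A →ₐ[k] B'} (h : Represents S g φ)
    (h' : Represents S g φ') : c.cls B = c.cls B' :=
  c.congr B B' (h.nonempty_equiv h').some

/-- For the zero ring both pieces of a scissor relation are again the zero ring, so its value
satisfies `c = c + c`. -/
theorem cls_eq_zero_of_subsingleton (A : Type u) [CommRing A] [Algebra k A]
    [Algebra.FiniteType k A] [Subsingleton A] : c.cls A = 0 := by
  have e : ∀ (B : Type u) [CommRing B] [Algebra k B] [Algebra.FiniteType k B] [Subsingleton B],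
      c.cls B = c.cls A := fun B _ _ _ _ =>
    c.congr B A (AlgEquiv.ofAlgHom
      { toFun := fun _ => 0, map_one' := Subsingleton.elim _ _, map_mul' := by simp,
        map_zero' := rfl, map_add' := by simp, commutes' := fun _ => Subsingleton.elim _ _ }
      { toFun := fun _ => 0, map_one' := Subsingleton.elim _ _, map_mul' := by simp,
        map_zero' := rfl, map_add' := by simp, commutes' := fun _ => Subsingleton.elim _ _ }
      (AlgHom.ext fun _ => Subsingleton.elim _ _) (AlgHom.ext fun _ => Subsingleton.elim _ _))
  have h := c.scissor A ⊤ 0 (by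
    ext p
    exact (p.isPrime.ne_top (Subsingleton.elim _ _)).elim)
  have h1 : Subsingleton (Localization.Away (0 : A)) :=
    (algebraMap A (Localization.Away (0 : A))).codomain_trivial
  have h2 : Subsingleton (A ⧸ (⊤ : Ideal A)) := inferInstance
  rw [e (A ⧸ (⊤ : Ideal A)), e (Localization.Away (0 : A))] at h
  exact left_eq_add.mp h

/-- Cut along `f = 0` with `f` the zero element: the closed piece may be taken to be `A ⧸ I`, and
the open piece is empty. -/
theorem cls_quotient_of_le_nilradical {A : Type u} [CommRing A] [Algebra k A]
    [Algebra.FiniteType k A] (I : Ideal A) (h : ∀ p : Ideal A, p.IsPrime → I ≤ p) :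
    c.cls (A ⧸ I) = c.cls A := by
  have h0 := c.scissor A I 0 (by
    ext p
    simpa [PrimeSpectrum.mem_zeroLocus] using h p.asIdeal p.isPrime)
  have h1 : Subsingleton (Localization.Away (0 : A)) := by
    rw [← subsingleton_iff_zero_eq_one]
    have := IsLocalization.Away.algebraMap_isUnit (S := Localization.Away (0 : A)) (0 : A)
    rw [map_zero, isUnit_zero_iff] at this
    exact this
  rw [h0, c.cls_eq_zero_of_subsingleton (Localization.Away (0 : A)), add_zero]

/-- The value of the invariant on the locus of `Spec A` where the elements of `S` vanish and `g` is
invertible. -/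
noncomputable def locus {A : Type u} [CommRing A] [Algebra k A] [Algebra.FiniteType k A]
    (S : Set A) (g : A) : Q :=
  c.cls (Localization.Away (Ideal.Quotient.mk (Ideal.span S) g))

theorem exists_represents {A : Type u} [CommRing A] [Algebra k A] (S : Set A) (g : A) :
    ∃ φ : A →ₐ[k] Localization.Away (Ideal.Quotient.mk (Ideal.span S) g), Represents S g φ := by
  have h := (Represents.mk_span (k := k) S).away g
  rw [one_mul] at h
  exact ⟨_, h⟩

variable {A : Type u} [CommRing A] [Algebra k A] [Algebra.FiniteType k A]

theorem locus_eq {B : Type u} [CommRing B] [Algebra k B] [Algebra.FiniteType k B] {S : Set A}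
    {g : A} {φ : A →ₐ[k] B} (h : Represents S g φ) : c.locus S g = c.cls B := by
  obtain ⟨φ', h'⟩ := exists_represents (k := k) S g
  exact c.cls_eq_of_represents h' h

/-- Testing on the residue fields of the representing ring puts `S'` inside every prime and `g'`
outside every prime. So `g'` is already a unit there, and dividing by `S'` only removes nilpotents.
-/
theorem locus_eq_union {S S' : Set A} {g g' : A}
    (h : ∀ (K : Type u) [Field K] [Algebra k K] (x : A →ₐ[k] K),
      (∀ s ∈ S, x s = 0) → x g ≠ 0 → (∀ s ∈ S', x s = 0) ∧ x g' ≠ 0) :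
    c.locus S g = c.locus (S ∪ S') (g * g') := by
  obtain ⟨φ, hφ⟩ := exists_represents (k := k) S g
  set B := Localization.Away (Ideal.Quotient.mk (Ideal.span S) g)
  have key : ∀ p : Ideal B, p.IsPrime → (∀ s ∈ S', φ s ∈ p) ∧ φ g' ∉ p := by
    intro p hp
    have := h p.ResidueField ((IsScalarTower.toAlgHom k B p.ResidueField).comp φ)
      (fun s hs => by simp [hφ.zero s hs])
      ((hφ.unit.map (IsScalarTower.toAlgHom k B p.ResidueField)).ne_zero)
    simpa using this
  have hu : IsUnit (φ g') := by
    by_contra hn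
    obtain ⟨m, hm, hgm⟩ := exists_max_ideal_of_mem_nonunits hn
    exact (key m hm.isPrime).2 hgm
  have h1 := hφ.quotient S'
  have h2 := h1.mul_of_isUnit (g' := g')
    (by simpa using hu.map (Ideal.Quotient.mk (Ideal.span (φ '' S'))))
  rw [c.locus_eq h2, c.locus_eq hφ, c.cls_quotient_of_le_nilradical]
  intro p hp
  rw [Ideal.span_le]
  rintro _ ⟨s, hs, rfl⟩
  exact (key p hp).1 s hs

/-- Each locus has the same value as the intersection of the two. All later comparisons of loci are
thereby reduced to field-valued points. -/
theorem locus_congr {S S' : Set A} {g g' : A}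
    (h : ∀ (K : Type u) [Field K] [Algebra k K] (x : A →ₐ[k] K),
      ((∀ s ∈ S, x s = 0) ∧ x g ≠ 0) ↔ ((∀ s ∈ S', x s = 0) ∧ x g' ≠ 0)) :
    c.locus S g = c.locus S' g' := by
  rw [c.locus_eq_union fun K _ _ x h1 h2 => (h K x).1 ⟨h1, h2⟩,
    c.locus_eq_union (S := S') fun K _ _ x h1 h2 => (h K x).2 ⟨h1, h2⟩, Set.union_comm, mul_comm]

theorem locus_scissor (S : Set A) (g f : A) :
    c.locus S g = c.locus (S ∪ {f}) g + c.locus S (g * f) := by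
  obtain ⟨φ, hφ⟩ := exists_represents (k := k) S g
  rw [c.locus_eq (hφ.quotient {f}), c.locus_eq (hφ.away f), c.locus_eq hφ]
  apply c.scissor
  rw [PrimeSpectrum.zeroLocus_span, Set.image_singleton]

theorem locus_eq_zero {S : Set A} {g : A}
    (h : ∀ (K : Type u) [Field K] [Algebra k K] (x : A →ₐ[k] K), (∀ s ∈ S, x s = 0) → x g = 0) :
    c.locus S g = 0 := by
  have h1 : c.locus S g = c.locus S 0 := c.locus_congr fun K _ _ x =>
    ⟨fun hx => absurd (h K x hx.1) hx.2, fun hx => absurd (map_zero x) hx.2⟩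
  obtain ⟨φ, hφ⟩ := exists_represents (k := k) S (0 : A)
  have h2 : Subsingleton (Localization.Away (Ideal.Quotient.mk (Ideal.span S) 0)) := by
    rw [← subsingleton_iff_zero_eq_one, ← isUnit_zero_iff]
    simpa using hφ.unit
  rw [h1, c.locus_eq hφ, c.cls_eq_zero_of_subsingleton]

theorem locus_cylinder (S : Set A) (g : A) :
    c.locus (Polynomial.C '' S) (Polynomial.C g) = 0 := by
  obtain ⟨φ, hφ⟩ := exists_represents (k := k) S g
  rw [c.locus_eq hφ.cylinder, c.polynomial]

theorem locus_graph (S : Set A) (g a b : A) :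
    c.locus (Polynomial.C '' S ∪ {Polynomial.C a * Polynomial.X + Polynomial.C b})
      (Polynomial.C (a * g)) = c.locus S (a * g) := by
  obtain ⟨φ, hφ⟩ := exists_represents (k := k) S (a * g)
  obtain ⟨φ', hφ'⟩ := hφ.graph b
  rw [c.locus_eq hφ', c.locus_eq hφ]

theorem cls_quotient_eq_locus (S : Set A) : c.cls (A ⧸ Ideal.span S) = c.locus S 1 :=
  (c.locus_eq (Represents.mk_span S)).symm

theorem locus_comp_equiv {A' : Type u} [CommRing A'] [Algebra k A'] [Algebra.FiniteType k A']
    (e : A' ≃ₐ[k] A) (S : Set A) (g : A) : c.locus (e ⁻¹' S) (e.symm g) = c.locus S g := by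
  obtain ⟨φ, hφ⟩ := exists_represents (k := k) S g
  rw [c.locus_eq hφ, c.locus_eq (hφ.comp_equiv e)]

-- The induction runs over the indices `s` whose `a_i` is not yet known to vanish. Each step cuts
-- both sides along `a_j = 0`. When `s` is empty the equations no longer involve `X`, the locus is a
-- cylinder, and the two terms on the right agree.
open Polynomial in
theorem locus_linear {ι : Type*} [DecidableEq ι] (a b : ι → A) (s : Finset ι) (S : Set A) (g : A)
    (hS : ∀ i ∉ s, a i ∈ S) :
    c.locus (C '' S ∪ Set.range fun i => C (a i) * X + C (b i)) (C g) =
      c.locus (S ∪ Set.range fun p : ι × ι => a p.1 * b p.2 - a p.2 * b p.1) g -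
        c.locus (S ∪ Set.range a) g := by
  have hC : ∀ (K : Type u) [Field K] [Algebra k K] (x : A[X] →ₐ[k] K), ∃ y : A →ₐ[k] K,
      ∀ r, x (C r) = y r := fun K _ _ x =>
    ⟨x.comp (IsScalarTower.toAlgHom k A A[X]), fun r => by simp⟩
  induction s using Finset.induction_on generalizing S g with
  | empty =>
    have h1 : c.locus (C '' S ∪ Set.range fun i => C (a i) * X + C (b i)) (C g) =
        c.locus (C '' (S ∪ Set.range b)) (C g) := c.locus_congr fun K _ _ x => by
      obtain ⟨y, hy⟩ := hC K x
      refine and_congr_left' ?_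
      simp only [Set.mem_union, or_imp, forall_and, Set.forall_mem_image, Set.forall_mem_range,
        map_add, map_mul, hy, Set.image_union, ← Set.range_comp, Function.comp_apply]
      refine and_congr_right fun hs => forall_congr' fun i => ?_
      rw [hs (hS i (by simp)), zero_mul, zero_add]
    have h2 : c.locus (S ∪ Set.range fun p : ι × ι => a p.1 * b p.2 - a p.2 * b p.1) g =
        c.locus (S ∪ Set.range a) g := c.locus_congr fun K _ _ x => by
      refine and_congr_left' ?_
      simp only [Set.mem_union, or_imp, forall_and, Set.forall_mem_range, map_sub, map_mul]
      refine and_congr_right fun hs => ?_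
      have ha : ∀ i, x (a i) = 0 := fun i => hs _ (hS i (by simp))
      simp [ha]
    rw [h1, h2, c.locus_cylinder, sub_self]
  | insert j s hj ih =>
    rw [c.locus_scissor _ (C g) (C (a j)),
      c.locus_scissor (S ∪ Set.range fun p : ι × ι => a p.1 * b p.2 - a p.2 * b p.1) g (a j),
      c.locus_scissor (S ∪ Set.range a) g (a j)]
    have ih' := ih (S ∪ {a j}) g fun i hi => by
      by_cases hij : i = j
      · subst hij; right; rfl
      · left; exact hS i (by simp [hij, hi])
    rw [Set.image_union, Set.image_singleton] at ih'
    rw [Set.union_right_comm, ih', Set.union_right_comm S (Set.range a),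
      Set.union_right_comm S (Set.range fun p : ι × ι => a p.1 * b p.2 - a p.2 * b p.1)]
    have h1 : c.locus (S ∪ Set.range a) (g * a j) = 0 := c.locus_eq_zero fun K _ _ x hx => by
      rw [map_mul, hx (a j) (Or.inr ⟨j, rfl⟩), mul_zero]
    -- On `a_j ≠ 0` the `j`-th equation determines `X`. The other equations become the minors
    -- involving `j`, and these imply all the minors.
    have h2 : c.locus (C '' S ∪ Set.range fun i => C (a i) * X + C (b i)) (C g * C (a j)) =
        c.locus (S ∪ Set.range fun p : ι × ι => a p.1 * b p.2 - a p.2 * b p.1) (g * a j) := by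
      rw [mul_comm g, ← c.locus_graph _ g (a j) (b j)]
      refine c.locus_congr fun K _ _ x => ?_
      obtain ⟨y, hy⟩ := hC K x
      rw [← map_mul, mul_comm g]
      refine and_congr_left fun hne => ?_
      rw [hy, map_mul] at hne
      have ha : y (a j) ≠ 0 := left_ne_zero_of_mul hne
      simp only [Set.mem_union, or_imp, forall_and, Set.forall_mem_image, Set.forall_mem_range,
        map_add, map_mul, hy, Set.image_union, ← Set.range_comp, Function.comp_apply,
        Set.mem_singleton_iff, forall_eq, and_assoc, map_sub]
      refine and_congr_right fun hs => ⟨fun h => ⟨fun p => ?_, h j⟩, fun h i => ?_⟩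
      · linear_combination y (a p.1) * h p.2 - y (a p.2) * h p.1
      · have h3 := h.1 (j, i)
        simp only at h3
        apply mul_left_cancel₀ ha
        linear_combination h3 + y (a i) * h.2
    rw [h1, h2]
    abel

/-- The value of the invariant on the common zero locus of `S` in affine space. -/
noncomputable def zeros {m : ℕ} (S : Set (MvPolynomial (Fin m) k)) : Q :=
  c.cls (MvPolynomial (Fin m) k ⧸ Ideal.span S)

open MvPolynomial in
theorem zeros_congr {m : ℕ} {S S' : Set (MvPolynomial (Fin m) k)}
    (h : ∀ (K : Type u) [Field K] [Algebra k K] (x : Fin m → K),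
      (∀ s ∈ S, aeval x s = 0) ↔ ∀ s ∈ S', aeval x s = 0) :
    c.zeros S = c.zeros S' := by
  rw [zeros, zeros, c.cls_quotient_eq_locus, c.cls_quotient_eq_locus]
  refine c.locus_congr fun K _ _ x => and_congr ?_ (by simp)
  have := h K fun i => x (X i)
  rw [show x = aeval fun i => x (X i) from algHom_ext fun i => by simp]
  exact this

open MvPolynomial in
/-- Elimination of a variable that occurs linearly. -/
theorem zeros_succ {m : ℕ} {ι : Type*} [Finite ι] (a b : ι → MvPolynomial (Fin m) k)
    {S : Set (MvPolynomial (Fin (m + 1)) k)} {T U : Set (MvPolynomial (Fin m) k)}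
    (hS : ∀ (K : Type u) [Field K] [Algebra k K] (t : K) (x : Fin m → K),
      (∀ s ∈ S, aeval (Fin.cons t x : Fin (m + 1) → K) s = 0) ↔
        ∀ i, aeval x (a i) * t + aeval x (b i) = 0)
    (hT : ∀ (K : Type u) [Field K] [Algebra k K] (x : Fin m → K), (∀ s ∈ T, aeval x s = 0) ↔
      ∀ i j, aeval x (a i) * aeval x (b j) = aeval x (a j) * aeval x (b i))
    (hU : ∀ (K : Type u) [Field K] [Algebra k K] (x : Fin m → K), (∀ s ∈ U, aeval x s = 0) ↔
      ∀ i, aeval x (a i) = 0) :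
    c.zeros S = c.zeros T - c.zeros U := by
  classical
  have := Fintype.ofFinite ι
  have h := c.locus_linear a b Finset.univ ∅ 1 (by simp)
  rw [c.zeros_congr (S := T) (S' := ∅ ∪ Set.range fun p : ι × ι => a p.1 * b p.2 - a p.2 * b p.1)
      fun K _ _ x => by
        rw [hT K x]
        simp only [Set.empty_union, Set.forall_mem_range, Prod.forall, map_sub, map_mul, sub_eq_zero],
    c.zeros_congr (S := U) (S' := ∅ ∪ Set.range a) fun K _ _ x => by rw [hU K x]; simp,
    zeros, zeros, zeros, c.cls_quotient_eq_locus, c.cls_quotient_eq_locus, c.cls_quotient_eq_locus,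
    ← h, ← c.locus_comp_equiv (finSuccEquiv k m)]
  refine c.locus_congr fun K _ _ x => and_congr ?_ (by simp)
  have hx : x = aeval (Fin.cons (x (X 0)) fun i => x (X i.succ) : Fin (m + 1) → K) :=
    algHom_ext fun i => by cases i using Fin.cases <;> simp
  have h1 := hS K (x (X 0)) fun i => x (X i.succ)
  rw [← hx] at h1
  rw [h1]
  let y : Polynomial (MvPolynomial (Fin m) k) →ₐ[k] K := x.comp (finSuccEquiv k m).symm.toAlgHom
  have hyX : y Polynomial.X = x (X 0) := by
    simp only [y]
    simp [← finSuccEquiv_X_zero]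
  have hyC : ∀ p, y (Polynomial.C p) = aeval (fun i => x (X i.succ)) p := by
    intro p
    have : y.comp (IsScalarTower.toAlgHom k (MvPolynomial (Fin m) k) _) =
        aeval (fun i => x (X i.succ)) := algHom_ext fun i => by
      simp [y, ← finSuccEquiv_X_succ]
    simpa using DFunLike.congr_fun this p
  have hy : ∀ q, x ((finSuccEquiv k m).symm q) = y q := fun q => rfl
  simp only [Set.image_empty, Set.empty_union]
  constructor
  · intro hh q hq
    obtain ⟨i, hi⟩ := hq
    have : x q = y (finSuccEquiv k m q) := by simp [y]
    rw [this, ← hi]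
    simpa [hyX, hyC] using hh i
  · intro hh i
    have := hh ((finSuccEquiv k m).symm (Polynomial.C (a i) * Polynomial.X + Polynomial.C (b i)))
      ⟨i, by simp⟩
    rw [hy] at this
    simpa [hyX, hyC] using this

/-- The empty system is linear in the first variable. Both terms of its elimination are the same
affine space. -/
theorem zeros_empty_succ (m : ℕ) : c.zeros (∅ : Set (MvPolynomial (Fin (m + 1)) k)) = 0 := by
  rw [c.zeros_succ (ι := Empty) (fun _ => 0) (fun _ => 0) (T := ∅) (U := ∅) (by simp) (by simp)
    (by simp), sub_self]

end AffineInvariant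

/-! ### Bordered matrices -/

namespace Matrix

variable {R : Type*} [CommRing R] {n : Type*} [Fintype n] [DecidableEq n]

/-- The matrix `M` bordered by the row `b`, the column `c` and the corner `a`. -/
def bordered {R n : Type*} (a : R) (b c : n → R) (M : Matrix n n R) :
    Matrix (Unit ⊕ n) (Unit ⊕ n) R :=
  fromBlocks (of fun _ _ => a) (replicateRow Unit b) (replicateCol Unit c) M

section

variable {R n : Type*} (a : R) (b c : n → R) (M : Matrix n n R)

@[simp]
theorem bordered_inl_inl (i j : Unit) : bordered a b c M (Sum.inl i) (Sum.inl j) = a := rfl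

@[simp]
theorem bordered_inl_inr (i : Unit) (j : n) :
    bordered a b c M (Sum.inl i) (Sum.inr j) = b j := rfl

@[simp]
theorem bordered_inr_inl (i : n) (j : Unit) :
    bordered a b c M (Sum.inr i) (Sum.inl j) = c i := rfl

@[simp]
theorem bordered_inr_inr (i j : n) : bordered a b c M (Sum.inr i) (Sum.inr j) = M i j := rfl

theorem bordered_transpose : (bordered a b c M)ᵀ = bordered a c b Mᵀ := by
  ext (i | i) (j | j) <;> rfl

end

variable {R : Type*} [CommRing R] {n : Type*} [Fintype n] [DecidableEq n]

/-- The lift is `X + M`, whose determinant is monic. Identities can thus be proved over `R[X]` by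
cancelling the determinant and then setting `X = 0`, with no invertibility assumption on `M`. -/
theorem exists_isRegular_det_map_eval (M : Matrix n n R) :
    ∃ N : Matrix n n (Polynomial R), IsRegular N.det ∧
      N.map (Polynomial.evalRingHom 0) = M := by
  refine ⟨charmatrix (-M), (charpoly_monic (-M)).isRegular, ?_⟩
  ext i j
  by_cases h : i = j
  · subst h; simp [charmatrix]
  · simp [charmatrix, h]

/-- The Schur complement formula, cleared of denominators: column operations make the block matrix
triangular. -/
theorem det_fromBlocks_mul_det_pow {p : Type*} [Fintype p] [DecidableEq p] (P : Matrix p p R)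
    (Q : Matrix p n R) (S : Matrix n p R) (M : Matrix n n R) :
    (fromBlocks P Q S M).det * M.det ^ Fintype.card p =
      (M.det • P - Q * M.adjugate * S).det * M.det := by
  have h : fromBlocks P Q S M * fromBlocks (M.det • 1) 0 (-(M.adjugate * S)) 1 =
      fromBlocks (M.det • P - Q * M.adjugate * S) Q 0 M := by
    rw [fromBlocks_multiply]
    congr 1
    · simp [Matrix.mul_assoc, sub_eq_add_neg]
    · simp
    · rw [Matrix.mul_neg, ← Matrix.mul_assoc, mul_adjugate]
      simp
    · simp
  have h' := congrArg det h
  rw [det_mul, det_fromBlocks_zero₁₂, det_fromBlocks_zero₂₁, det_smul, det_one, det_one, mul_one,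
    mul_one] at h'
  exact h'

theorem det_bordered (a : R) (b c : n → R) (M : Matrix n n R) :
    (bordered a b c M).det = a * M.det - b ⬝ᵥ (M.adjugate *ᵥ c) := by
  obtain ⟨N, hN, rfl⟩ := exists_isRegular_det_map_eval M
  have h := det_fromBlocks_mul_det_pow (of fun _ _ : Unit => Polynomial.C a)
    (replicateRow Unit fun j => Polynomial.C (b j)) (replicateCol Unit fun i => Polynomial.C (c i)) N
  rw [Fintype.card_unit, pow_one] at h
  have h' := congrArg (Polynomial.evalRingHom 0) (hN.right h)
  rw [RingHom.map_det, RingHom.mapMatrix_apply, det_unique (n := Unit)] at h'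
  convert h' using 1
  · refine congrArg det ?_
    ext (i | i) (j | j) <;> simp
  · rw [← RingHom.mapMatrix_apply, ← RingHom.map_adjugate, ← RingHom.map_det]
    simp only [sub_apply, smul_apply, map_sub, smul_eq_mul, map_mul, mul_apply, map_sum,
      dotProduct, mulVec, RingHom.mapMatrix_apply, map_apply, Finset.sum_mul, Finset.mul_sum]
    congr 1
    · simp [mul_comm]
    · rw [Finset.sum_comm]
      simp [mul_assoc]

theorem det_bordered_add (a t : R) (b c : n → R) (M : Matrix n n R) :
    (bordered (a + t) b c M).det = M.det * t + (bordered a b c M).det := by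
  rw [det_bordered, det_bordered]; ring

/-- The Desnanot-Jacobi identity. -/
theorem det_bordered_bordered_mul_det (a a' : R) (b c : Unit ⊕ n → R) (r s : n → R)
    (M : Matrix n n R) :
    (bordered a b c (bordered a' r s M)).det * M.det =
      (bordered a (b ∘ Sum.inr) (c ∘ Sum.inr) M).det * (bordered a' r s M).det -
        (bordered (b (Sum.inl ())) (b ∘ Sum.inr) s M).det *
          (bordered (c (Sum.inl ())) r (c ∘ Sum.inr) M).det := by
  obtain ⟨N, hN, rfl⟩ := exists_isRegular_det_map_eval M
  -- The two successive borders are merged into one border of width two. The Schur complement is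
  -- then a 2×2 matrix, and each of its entries is a singly bordered determinant.
  let P : Matrix (Fin 2) (Fin 2) (Polynomial R) :=
    !![Polynomial.C a, Polynomial.C (b (Sum.inl ())); Polynomial.C (c (Sum.inl ())), Polynomial.C a']
  let U : Matrix (Fin 2) n (Polynomial R) :=
    of ![fun j => Polynomial.C (b (Sum.inr j)), fun j => Polynomial.C (r j)]
  let V : Matrix n (Fin 2) (Polynomial R) :=
    of fun i => ![Polynomial.C (c (Sum.inr i)), Polynomial.C (s i)]
  have h := det_fromBlocks_mul_det_pow P U V N
  rw [Fintype.card_fin, pow_two, ← mul_assoc] at h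
  have h' := congrArg (Polynomial.evalRingHom 0) (hN.right h)
  rw [map_mul, RingHom.map_det, det_fin_two, RingHom.mapMatrix_apply, RingHom.map_det,
    RingHom.mapMatrix_apply] at h'
  have hb : ∀ (x : R) (y z : n → R),
      (bordered x y z (N.map (Polynomial.evalRingHom 0))).det = Polynomial.evalRingHom 0
        (Polynomial.C x * N.det -
          ∑ j, (∑ i, Polynomial.C (y i) * N.adjugate i j) * Polynomial.C (z j)) := by
    intro x y z
    rw [det_bordered, ← RingHom.mapMatrix_apply, ← RingHom.map_adjugate, ← RingHom.map_det]
    simp only [map_sub, map_mul, map_sum, dotProduct, mulVec, RingHom.mapMatrix_apply, map_apply,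
      Finset.sum_mul, Finset.mul_sum]
    congr 1
    · simp
    · rw [Finset.sum_comm]
      simp [mul_assoc]
  rw [hb, hb, hb, hb]
  convert h' using 1
  · congr 1
    let e : Fin 2 ⊕ n ≃ Unit ⊕ (Unit ⊕ n) :=
      { toFun := Sum.elim ![Sum.inl (), Sum.inr (Sum.inl ())] (Sum.inr ∘ Sum.inr)
        invFun := Sum.elim (fun _ => Sum.inl 0) (Sum.elim (fun _ => Sum.inl 1) Sum.inr)
        left_inv := by
          rintro (i | i)
          · fin_cases i <;> rfl
          · rfl
        right_inv := by rintro (i | i | i) <;> rfl }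
    rw [← det_submatrix_equiv_self e]
    refine congrArg det ?_
    ext (i | i) (j | j)
    · fin_cases i <;> fin_cases j <;> simp [e, P]
    · fin_cases i <;> simp [e, U]
    · fin_cases j <;> simp [e, V]
    · simp [e]
  · have hm : ∀ i j, (U * N.adjugate * V) i j = ∑ x, (∑ y, U i y * N.adjugate y x) * V x j :=
      fun i j => by simp only [mul_apply]
    rw [← map_mul, ← map_mul, ← map_sub]
    refine congrArg _ ?_
    simp only [sub_apply, smul_apply, hm, smul_eq_mul, P, U, V, of_apply, cons_val_zero,
      cons_val_one, Function.comp_apply]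
    ring

/-- Interchanging the two border indices moves the varying corner to the outside, where
`det_bordered_add` applies. -/
theorem det_bordered_bordered_add (a a' t : R) (b c : Unit ⊕ n → R) (r s : n → R)
    (M : Matrix n n R) :
    (bordered a b c (bordered (a' + t) r s M)).det =
      (bordered a (b ∘ Sum.inr) (c ∘ Sum.inr) M).det * t +
        (bordered a b c (bordered a' r s M)).det := by
  let e : Unit ⊕ (Unit ⊕ n) ≃ Unit ⊕ (Unit ⊕ n) :=
    (Equiv.sumAssoc _ _ _).symm.trans
      ((Equiv.sumCongr (Equiv.sumComm _ _) (Equiv.refl _)).trans (Equiv.sumAssoc _ _ _))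
  have h : ∀ y, (bordered a b c (bordered y r s M)).det =
      (bordered y (Sum.elim (fun _ => c (Sum.inl ())) r) (Sum.elim (fun _ => b (Sum.inl ())) s)
        (bordered a (b ∘ Sum.inr) (c ∘ Sum.inr) M)).det := by
    intro y
    rw [← det_submatrix_equiv_self e]
    congr 1
    ext (i | i | i) (j | j | j) <;> rfl
  rw [h, h, det_bordered_add]

/-- An entry of the adjugate is a determinant with one row replaced by a unit vector. Replacing the
first row removes the corner; replacing another row leaves a determinant linear in the corner, whose
leading coefficient is a cofactor of `M` or zero. -/
theorem adjugate_bordered_add (a t : R) (b c : n → R) (M : Matrix n n R) :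
    (bordered (a + t) b c M).adjugate =
      (bordered a b c M).adjugate + t • fromBlocks 0 0 0 M.adjugate := by
  have h0 : bordered (a + t) b c M = (bordered a b c M).updateRow (Sum.inl ())
      ((bordered a b c M) (Sum.inl ()) + t • Pi.single (Sum.inl ()) 1) := by
    ext (i | i) (j | j) <;> simp [updateRow_apply]
  ext i (j | j)
  · rw [add_apply, adjugate_apply, adjugate_apply, h0, updateRow_idem]
    rcases i with i | i <;> simp
  · have hne : (Sum.inl () : Unit ⊕ n) ≠ Sum.inr j := by simp
    have h1 : (((bordered a b c M).updateRow (Sum.inr j) (Pi.single i 1)).updateRow (Sum.inl ())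
        (Pi.single (Sum.inl ()) 1)).det = fromBlocks (0 : Matrix Unit Unit R) 0 0 M.adjugate i
          (Sum.inr j) := by
      rcases i with i | i
      · refine (det_zero_of_row_eq hne ?_).trans (by simp)
        ext q
        simp [updateRow_apply]
      · rw [fromBlocks_apply₂₂, adjugate_apply]
        have : ((bordered a b c M).updateRow (Sum.inr j) (Pi.single (Sum.inr i) 1)).updateRow
            (Sum.inl ()) (Pi.single (Sum.inl ()) 1) =
            fromBlocks (1 : Matrix Unit Unit R) 0 (replicateCol Unit fun p => if p = j then 0 else c p)
              (M.updateRow j (Pi.single i 1)) := by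
          ext (p | p) (q | q)
          · simp
          · simp
          · by_cases h : p = j <;> simp [updateRow_apply, h]
          · by_cases h : p = j <;> simp [updateRow_apply, h, Pi.single_apply]
        rw [this, det_fromBlocks_zero₁₂, det_one, one_mul]
    rw [add_apply, smul_apply, adjugate_apply, adjugate_apply, h0, updateRow_comm _ hne,
      det_updateRow_add, det_updateRow_smul, h1]
    congr 1
    congr 1
    ext p q
    by_cases h : p = Sum.inl ()
    · subst h; simp [updateRow_apply]
    · simp [updateRow_apply, h]

variable {F : Type*} [Field F]

/-- If the adjugate is nonzero, the kernel of `S` is the line through `w`. The columns of the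
adjugate lie in it, and by symmetry so do the rows. -/
theorem exists_adjugate_eq_smul_vecMulVec {S : Matrix n n F} (hS : S.IsSymm) {w : n → F}
    (hw : w ≠ 0) (h : S *ᵥ w = 0) : ∃ c : F, S.adjugate = c • vecMulVec w w := by
  by_cases hadj : S.adjugate = 0
  · exact ⟨0, by simp [hadj]⟩
  obtain ⟨i, j, hij⟩ : ∃ i j, S.adjugate i j ≠ 0 := by
    by_contra! hh
    exact hadj (by ext i j; exact hh i j)
  -- The nonzero cofactor is the determinant of `S` with row `j` replaced by the `i`-th unit vector.
  -- A kernel vector with zero `i`-th coordinate is killed by that invertible matrix.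
  have hker : ∀ u : n → F, S *ᵥ u = 0 → u i = 0 → u = 0 := by
    intro u hu hui
    by_contra hne
    apply hij
    rw [adjugate_apply, ← exists_mulVec_eq_zero_iff]
    refine ⟨u, hne, ?_⟩
    ext p
    by_cases hp : p = j
    · subst hp; simp [mulVec, hui]
    · have := congrFun hu p
      simpa [mulVec, updateRow_ne hp] using this
  have hwi : w i ≠ 0 := fun h0 => hw (hker w h h0)
  have hdet : S.det = 0 := exists_mulVec_eq_zero_iff.mp ⟨w, hw, h⟩
  have hcol : ∀ p q, S.adjugate p q = S.adjugate i q / w i * w p := by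
    intro p q
    have h1 : S *ᵥ (fun r => S.adjugate r q) = 0 := by
      have := congrFun₂ (mul_adjugate S)
      ext r
      have := this r q
      simpa [hdet, mul_apply, mulVec, dotProduct] using this
    have h2 := hker ((fun r => S.adjugate r q) - (S.adjugate i q / w i) • w)
      (by rw [mulVec_sub, mulVec_smul, h, h1]; simp) (by simp [hwi])
    have := congrFun h2 p
    simpa [sub_eq_zero] using this
  have hsymm : ∀ p q, S.adjugate p q = S.adjugate q p := fun p q => by
    rw [← transpose_apply S.adjugate, adjugate_transpose, hS.eq]
  refine ⟨S.adjugate i i / w i / w i, ?_⟩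
  ext p q
  rw [hcol p q, hsymm i q, hcol q i]
  simp [vecMulVec_apply]
  field_simp

/-- The coefficients of the linear polynomial `adjugate (bordered (a + t) b b M)` in `t` are
proportional exactly when `M` and `bordered a b b M` are singular. -/
theorem adjugate_bordered_proportional_iff [Nonempty n] (a : F) (b : n → F) {M : Matrix n n F}
    (hM : M.IsSymm) :
    (∀ i j i' j', fromBlocks (0 : Matrix Unit Unit F) 0 0 M.adjugate i j *
        (bordered a b b M).adjugate i' j' =
      fromBlocks (0 : Matrix Unit Unit F) 0 0 M.adjugate i' j' * (bordered a b b M).adjugate i j) ↔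
    M.det = 0 ∧ (bordered a b b M).det = 0 := by
  have hdet : ∀ {p : Type _} [Fintype p] [DecidableEq p] [Nonempty p] (N : Matrix p p F),
      N.adjugate = 0 → N.det = 0 := by
    intro p _ _ _ N hN
    obtain ⟨i⟩ := ‹Nonempty p›
    have := congrFun₂ (mul_adjugate N) i i
    simpa [hN] using this.symm
  have h00 : ∀ t, (bordered (a + t) b b M).adjugate (Sum.inl ()) (Sum.inl ()) = M.det := by
    intro t
    have : (bordered (a + t) b b M).updateRow (Sum.inl ()) (Pi.single (Sum.inl ()) 1) =
        bordered 1 0 b M := by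
      ext (p | p) (q | q) <;> simp [updateRow_apply]
    rw [adjugate_apply, this, det_bordered]
    simp
  constructor
  · intro h
    by_cases hα : M.adjugate = 0
    · have h1 := hdet M hα
      exact ⟨h1, by simp [det_bordered, h1, hα]⟩
    · obtain ⟨i, j, hij⟩ : ∃ i j, M.adjugate i j ≠ 0 := by
        by_contra! hh
        exact hα (by ext i j; exact hh i j)
      set t := -(bordered a b b M).adjugate (Sum.inr i) (Sum.inr j) / M.adjugate i j with ht
      have h2 : (bordered (a + t) b b M).adjugate = 0 := by
        rw [adjugate_bordered_add]
        ext p q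
        have := h (Sum.inr i) (Sum.inr j) p q
        rw [fromBlocks_apply₂₂] at this
        rw [add_apply, smul_apply, zero_apply, smul_eq_mul, ht]
        field_simp
        linear_combination this
      have h3 := h00 t
      rw [h2, zero_apply] at h3
      have h4 := hdet _ h2
      rw [det_bordered_add, ← h3, zero_mul, zero_add] at h4
      exact ⟨h3.symm, h4⟩
  · rintro ⟨h1, h2⟩
    obtain ⟨v, hv, hMv⟩ := exists_mulVec_eq_zero_iff.mpr h1
    obtain ⟨e, he⟩ := exists_adjugate_eq_smul_vecMulVec hM hv hMv
    by_cases he0 : e = 0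
    · have : M.adjugate = 0 := by simp [he, he0]
      simp [this]
    -- The bordered determinant is `-e (b ⬝ᵥ v)²`. So `(0, v)` lies in the kernel of the bordered
    -- matrix, and both adjugates are multiples of the same rank-one matrix.
    · have hbv : b ⬝ᵥ v = 0 := by
        rw [det_bordered, h1, he, smul_mulVec, vecMulVec_mulVec] at h2
        simp [he0, dotProduct_comm] at h2
        simpa [dotProduct_comm] using h2
      have hS : (bordered a b b M).IsSymm := by
        rw [IsSymm, bordered_transpose, hM.eq]
      obtain ⟨f, hf⟩ := exists_adjugate_eq_smul_vecMulVec hS (w := Sum.elim 0 v)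
        (fun h0 => hv (by ext i; exact congrFun h0 (Sum.inr i)))
        (by
          ext (i | i)
          · simpa [mulVec, dotProduct] using hbv
          · simpa [mulVec, dotProduct] using congrFun hMv i)
      have hα : fromBlocks (0 : Matrix Unit Unit F) 0 0 M.adjugate =
          e • vecMulVec (Sum.elim 0 v) (Sum.elim 0 v) := by
        rw [he]
        ext (i | i) (j | j) <;> simp [vecMulVec_apply]
      intro i j i' j'
      rw [hα, hf]
      simp only [smul_apply, smul_eq_mul]
      ring

end Matrix

/-! ### Symmetric pencils with variables on the diagonal. -/

namespace Matrix

section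

variable {R R' n n' : Type*}

theorem bordered_map (f : R → R') (a : R) (b c : n → R) (M : Matrix n n R) :
    (bordered a b c M).map f = bordered (f a) (f ∘ b) (f ∘ c) (M.map f) := by
  ext (i | i) (j | j) <;> rfl

theorem det_bordered_submatrix [CommRing R] [Fintype n] [DecidableEq n] [Fintype n']
    [DecidableEq n'] (a : R) (b c : n' → R) (M : Matrix n' n' R) (e : n ≃ n') :
    (bordered a (b ∘ e) (c ∘ e) (M.submatrix e e)).det = (bordered a b c M).det := by
  rw [← det_submatrix_equiv_self (Equiv.sumCongr (Equiv.refl Unit) e)]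
  refine congrArg det ?_
  ext (i | i) (j | j) <;> rfl

end

variable {k : Type*} [Field k] {m : ℕ} {l : Type*}

/-- The matrix `A` with the variables `x` added to the first `m` diagonal entries. -/
def pencil (A : Matrix (Fin m ⊕ l) (Fin m ⊕ l) k) {R : Type*} [CommRing R] [Algebra k R]
    (x : Fin m → R) : Matrix (Fin m ⊕ l) (Fin m ⊕ l) R :=
  A.map (algebraMap k R) + fromBlocks (diagonal x) 0 0 0

variable {R R' : Type*} [CommRing R] [Algebra k R] [CommRing R'] [Algebra k R']

theorem pencil_map (A : Matrix (Fin m ⊕ l) (Fin m ⊕ l) k) (f : R →ₐ[k] R') (x : Fin m → R) :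
    (pencil A x).map f = pencil A (f ∘ x) := by
  ext (i | i) (j | j)
  · by_cases h : i = j
    · subst h; simp [pencil]
    · simp [pencil, h]
  all_goals simp [pencil]

theorem pencil_isSymm {A : Matrix (Fin m ⊕ l) (Fin m ⊕ l) k} (hA : A.IsSymm) (x : Fin m → R) :
    (pencil A x).IsSymm := by
  rw [pencil]
  refine IsSymm.add (hA.map _) ?_
  rw [IsSymm, fromBlocks_transpose]
  simp

/-- The index set of a pencil in `m + 1` variables with its first element split off. -/
def sumSuccEquiv (m : ℕ) (l : Type*) : Unit ⊕ (Fin m ⊕ l) ≃ Fin (m + 1) ⊕ l where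
  toFun := Sum.elim (fun _ => Sum.inl 0) (Sum.map Fin.succ id)
  invFun := Sum.elim (Fin.cases (Sum.inl ()) fun i => Sum.inr (Sum.inl i)) (Sum.inr ∘ Sum.inr)
  left_inv := by rintro (i | i | i) <;> rfl
  right_inv := by
    rintro (i | i)
    · cases i using Fin.cases <;> rfl
    · rfl

theorem pencil_cons (A : Matrix (Fin (m + 1) ⊕ l) (Fin (m + 1) ⊕ l) k) (t : R) (x : Fin m → R) :
    (pencil A (Fin.cons t x : Fin (m + 1) → R)).submatrix (sumSuccEquiv m l) (sumSuccEquiv m l) =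
      bordered (algebraMap k R (A (Sum.inl 0) (Sum.inl 0)) + t)
        (algebraMap k R ∘ fun j => A (Sum.inl 0) (Sum.map Fin.succ id j))
        (algebraMap k R ∘ fun j => A (Sum.map Fin.succ id j) (Sum.inl 0))
        (pencil (A.submatrix (Sum.map Fin.succ id) (Sum.map Fin.succ id)) x) := by
  ext (i | i | i) (j | j | j)
  · simp [pencil, sumSuccEquiv]
  · simp [pencil, sumSuccEquiv, (Fin.succ_ne_zero _).symm]
  · simp [pencil, sumSuccEquiv]
  · simp [pencil, sumSuccEquiv]
  · by_cases h : i = j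
    · subst h; simp [pencil, sumSuccEquiv]
    · simp [pencil, sumSuccEquiv, h]
  all_goals simp [pencil, sumSuccEquiv]

variable [Fintype l] [DecidableEq l]

theorem det_bordered_pencil_map (f : R →ₐ[k] R') (a : k) (b c : Fin m ⊕ l → k)
    (A : Matrix (Fin m ⊕ l) (Fin m ⊕ l) k) (x : Fin m → R) :
    f (bordered (algebraMap k R a) (algebraMap k R ∘ b) (algebraMap k R ∘ c) (pencil A x)).det =
      (bordered (algebraMap k R' a) (algebraMap k R' ∘ b) (algebraMap k R' ∘ c)
        (pencil A (f ∘ x))).det := by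
  rw [AlgHom.map_det, AlgHom.mapMatrix_apply, bordered_map, pencil_map]
  simp only [← Function.comp_assoc, AlgHom.commutes]
  congr 2 <;> · ext; simp

theorem det_pencil_map (f : R →ₐ[k] R') (A : Matrix (Fin m ⊕ l) (Fin m ⊕ l) k) (x : Fin m → R) :
    f (pencil A x).det = (pencil A (f ∘ x)).det := by
  rw [AlgHom.map_det, AlgHom.mapMatrix_apply, pencil_map]

theorem adjugate_pencil_map (f : R →ₐ[k] R') (A : Matrix (Fin m ⊕ l) (Fin m ⊕ l) k)
    (x : Fin m → R) (i j : Fin m ⊕ l) :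
    f ((pencil A x).adjugate i j) = (pencil A (f ∘ x)).adjugate i j := by
  rw [← pencil_map, ← AlgHom.mapMatrix_apply, ← AlgHom.map_adjugate]
  rfl

theorem det_pencil_cons (A : Matrix (Fin (m + 1) ⊕ l) (Fin (m + 1) ⊕ l) k) (t : R)
    (x : Fin m → R) :
    (pencil A (Fin.cons t x : Fin (m + 1) → R)).det =
      (pencil (A.submatrix (Sum.map Fin.succ id) (Sum.map Fin.succ id)) x).det * t +
        (pencil A (Fin.cons 0 x : Fin (m + 1) → R)).det := by
  rw [← det_submatrix_equiv_self (sumSuccEquiv m l), pencil_cons, det_bordered_add,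
    ← det_submatrix_equiv_self (sumSuccEquiv m l) (pencil A _), pencil_cons, add_zero]

theorem det_bordered_pencil_cons (a : R) (b c : Fin (m + 1) ⊕ l → R)
    (A : Matrix (Fin (m + 1) ⊕ l) (Fin (m + 1) ⊕ l) k) (t : R) (x : Fin m → R) :
    (bordered a b c (pencil A (Fin.cons t x : Fin (m + 1) → R))).det =
      (bordered a (b ∘ Sum.map Fin.succ id) (c ∘ Sum.map Fin.succ id)
        (pencil (A.submatrix (Sum.map Fin.succ id) (Sum.map Fin.succ id)) x)).det * t +
        (bordered a b c (pencil A (Fin.cons 0 x : Fin (m + 1) → R))).det := by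
  rw [← det_bordered_submatrix _ _ _ _ (sumSuccEquiv m l), pencil_cons, det_bordered_bordered_add,
    ← det_bordered_submatrix _ _ _ (pencil A _) (sumSuccEquiv m l), pencil_cons, add_zero]
  rfl

theorem adjugate_pencil_cons (A : Matrix (Fin (m + 1) ⊕ l) (Fin (m + 1) ⊕ l) k) (t : R)
    (x : Fin m → R) (i j : Unit ⊕ (Fin m ⊕ l)) :
    (pencil A (Fin.cons t x : Fin (m + 1) → R)).adjugate (sumSuccEquiv m l i)
        (sumSuccEquiv m l j) =
      fromBlocks (0 : Matrix Unit Unit R) 0 0 (pencil (A.submatrix (Sum.map Fin.succ id)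
        (Sum.map Fin.succ id)) x).adjugate i j * t +
        (pencil A (Fin.cons 0 x : Fin (m + 1) → R)).adjugate (sumSuccEquiv m l i)
          (sumSuccEquiv m l j) := by
  rw [← submatrix_apply (pencil A (Fin.cons t x : Fin (m + 1) → R)).adjugate,
    ← adjugate_submatrix_equiv_self, pencil_cons, adjugate_bordered_add,
    ← submatrix_apply (pencil A (Fin.cons 0 x : Fin (m + 1) → R)).adjugate,
    ← adjugate_submatrix_equiv_self, pencil_cons, add_zero, add_apply, smul_apply, smul_eq_mul]
  ring

/-- In the Desnanot-Jacobi identity the two mixed bordered determinants are transposes of each other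
by symmetry, so their product is a square. This evaluates the minor of the pair formed by the
determinant and the bordered determinant. -/
theorem det_bordered_pencil_mul_det (a : R) (b : Fin (m + 1) ⊕ l → R)
    {A : Matrix (Fin (m + 1) ⊕ l) (Fin (m + 1) ⊕ l) k} (hA : A.IsSymm) (x : Fin m → R) :
    (bordered a b b (pencil A (Fin.cons 0 x : Fin (m + 1) → R))).det *
        (pencil (A.submatrix (Sum.map Fin.succ id) (Sum.map Fin.succ id)) x).det =
      (bordered a (b ∘ Sum.map Fin.succ id) (b ∘ Sum.map Fin.succ id)
        (pencil (A.submatrix (Sum.map Fin.succ id) (Sum.map Fin.succ id)) x)).det *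
        (pencil A (Fin.cons 0 x : Fin (m + 1) → R)).det -
      (bordered (b (Sum.inl 0)) (b ∘ Sum.map Fin.succ id)
        (algebraMap k R ∘ fun j => A (Sum.map Fin.succ id j) (Sum.inl 0))
        (pencil (A.submatrix (Sum.map Fin.succ id) (Sum.map Fin.succ id)) x)).det ^ 2 := by
  have hsymm : (algebraMap k R ∘ fun j : Fin m ⊕ l => A (Sum.inl 0) (Sum.map Fin.succ id j)) =
      algebraMap k R ∘ fun j => A (Sum.map Fin.succ id j) (Sum.inl 0) := by
    ext j
    simp [hA.apply]
  rw [← det_bordered_submatrix _ _ _ _ (sumSuccEquiv m l), pencil_cons,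
    det_bordered_bordered_mul_det,
    ← det_submatrix_equiv_self (sumSuccEquiv m l) (pencil A _), pencil_cons, hsymm,
    ← det_transpose (bordered _ (algebraMap k R ∘ _) ((b ∘ sumSuccEquiv m l) ∘ Sum.inr) _),
    bordered_transpose, (pencil_isSymm (hA.submatrix _) x).eq, pow_two]
  rfl

/-- The base of the three inductions: with no variables left, the pencil is its constant lower
block. -/
theorem det_bordered_pencil_zero [Nonempty l] (a : R) (b c : Fin 0 ⊕ l → R)
    {A : Matrix (Fin 0 ⊕ l) (Fin 0 ⊕ l) k} (hA : (A.submatrix Sum.inr Sum.inr).adjugate = 0)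
    (x : Fin 0 → R) :
    (pencil A x).adjugate = 0 ∧ (pencil A x).det = 0 ∧
      (bordered a b c (pencil A x)).det = 0 := by
  have h1 : (pencil A x).adjugate = 0 := by
    have h : (pencil A x).submatrix (Equiv.emptySum (Fin 0) l).symm (Equiv.emptySum (Fin 0) l).symm =
        (algebraMap k R).mapMatrix (A.submatrix Sum.inr Sum.inr) := by
      ext i j
      simp [pencil]
    have h' := congrArg adjugate h
    rw [adjugate_submatrix_equiv_self, ← RingHom.map_adjugate, hA, map_zero] at h'
    ext (i | i) (j | j)
    · exact i.elim0
    · exact i.elim0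
    · exact j.elim0
    · exact congrFun₂ h' i j
  have h2 : (pencil A x).det = 0 := by
    obtain ⟨i⟩ := ‹Nonempty l›
    have := congrFun₂ (mul_adjugate (pencil A x)) (Sum.inr i) (Sum.inr i)
    simpa [h1] using this.symm
  exact ⟨h1, h2, by simp [det_bordered, h1, h2]⟩

end Matrix

/-! ### Determinantal loci have the value of affine space. -/

namespace AffineInvariant

open Matrix MvPolynomial

variable {k : Type u} [Field k] {Q : Type w} [AddCommGroup Q] (c : AffineInvariant k Q)
  {l : Type*} [Fintype l] [DecidableEq l] [Nonempty l]

theorem aeval_comp_X {σ : Type*} {K : Type*} [CommRing K] [Algebra k K] (x : σ → K) :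
    aeval (R := k) x ∘ X = x := by
  ext i; simp

theorem aeval_comp_cons {m : ℕ} {K : Type*} [CommRing K] [Algebra k K] (x : Fin m → K) :
    aeval (R := k) x ∘ (Fin.cons 0 X : Fin (m + 1) → MvPolynomial (Fin m) k) =
      (Fin.cons 0 x : Fin (m + 1) → K) := by
  ext i; cases i using Fin.cases <;> simp

/-- A single linear equation has only trivial minors, and its leading coefficient is a bordered
determinant in one variable less. The borders may differ because `zeros_det_pencil_pair` produces
unequal ones. -/
theorem zeros_det_bordered_pencil {m : ℕ} (a : k) (b d : Fin m ⊕ l → k)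
    (A : Matrix (Fin m ⊕ l) (Fin m ⊕ l) k) (hA : (A.submatrix Sum.inr Sum.inr).adjugate = 0) :
    c.zeros {(bordered (algebraMap k _ a) (algebraMap k _ ∘ b) (algebraMap k _ ∘ d)
      (pencil A (X : Fin m → MvPolynomial (Fin m) k))).det} =
      c.zeros (∅ : Set (MvPolynomial (Fin m) k)) := by
  induction m with
  | zero =>
    rw [(det_bordered_pencil_zero _ _ _ hA _).2.2]
    exact c.zeros_congr fun K _ _ x => by simp
  | succ m ih =>
    rw [c.zeros_succ (ι := Unit)
      (fun _ => (bordered (algebraMap k _ a) (algebraMap k _ ∘ b ∘ Sum.map Fin.succ id)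
        (algebraMap k _ ∘ d ∘ Sum.map Fin.succ id)
        (pencil (A.submatrix (Sum.map Fin.succ id) (Sum.map Fin.succ id))
          (X : Fin m → MvPolynomial (Fin m) k))).det)
      (fun _ => (bordered (algebraMap k _ a) (algebraMap k _ ∘ b) (algebraMap k _ ∘ d)
        (pencil A (Fin.cons 0 X : Fin (m + 1) → MvPolynomial (Fin m) k))).det)
      (T := ∅) (U := {(bordered (algebraMap k _ a) (algebraMap k _ ∘ b ∘ Sum.map Fin.succ id)
        (algebraMap k _ ∘ d ∘ Sum.map Fin.succ id)
        (pencil (A.submatrix (Sum.map Fin.succ id) (Sum.map Fin.succ id))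
          (X : Fin m → MvPolynomial (Fin m) k))).det}) ?_ (by simp) (by simp),
      ih, sub_self, zeros_empty_succ]
    · exact hA
    · intro K _ _ t x
      simp only [Set.mem_singleton_iff, forall_eq, forall_const, det_bordered_pencil_map,
        aeval_comp_X, aeval_comp_cons]
      rw [det_bordered_pencil_cons]
      rfl

/-- The leading coefficients form a pair of the same kind, and the minor is a square up to sign, so
it can be replaced by its root, one bordered determinant. -/
theorem zeros_det_pencil_pair {m : ℕ} (a : k) (b : Fin m ⊕ l → k)
    {A : Matrix (Fin m ⊕ l) (Fin m ⊕ l) k} (hs : A.IsSymm)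
    (hA : (A.submatrix Sum.inr Sum.inr).adjugate = 0) :
    c.zeros {(pencil A (X : Fin m → MvPolynomial (Fin m) k)).det,
      (bordered (algebraMap k _ a) (algebraMap k _ ∘ b) (algebraMap k _ ∘ b)
        (pencil A (X : Fin m → MvPolynomial (Fin m) k))).det} =
      c.zeros (∅ : Set (MvPolynomial (Fin m) k)) := by
  induction m with
  | zero =>
    rw [(det_bordered_pencil_zero _ _ _ hA _).2.2, (det_bordered_pencil_zero 0 0 0 hA _).2.1]
    exact c.zeros_congr fun K _ _ x => by simp
  | succ m ih =>
    rw [c.zeros_succ (ι := Fin 2)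
      ![(pencil (A.submatrix (Sum.map Fin.succ id) (Sum.map Fin.succ id))
          (X : Fin m → MvPolynomial (Fin m) k)).det,
        (bordered (algebraMap k _ a) (algebraMap k _ ∘ b ∘ Sum.map Fin.succ id)
          (algebraMap k _ ∘ b ∘ Sum.map Fin.succ id)
          (pencil (A.submatrix (Sum.map Fin.succ id) (Sum.map Fin.succ id))
            (X : Fin m → MvPolynomial (Fin m) k))).det]
      ![(pencil A (Fin.cons 0 X : Fin (m + 1) → MvPolynomial (Fin m) k)).det,
        (bordered (algebraMap k _ a) (algebraMap k _ ∘ b) (algebraMap k _ ∘ b)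
          (pencil A (Fin.cons 0 X : Fin (m + 1) → MvPolynomial (Fin m) k))).det]
      (T := {(bordered (algebraMap k _ (b (Sum.inl 0))) (algebraMap k _ ∘ b ∘ Sum.map Fin.succ id)
          (algebraMap k _ ∘ fun j => A (Sum.map Fin.succ id j) (Sum.inl 0))
          (pencil (A.submatrix (Sum.map Fin.succ id) (Sum.map Fin.succ id))
            (X : Fin m → MvPolynomial (Fin m) k))).det})
      (U := {(pencil (A.submatrix (Sum.map Fin.succ id) (Sum.map Fin.succ id))
          (X : Fin m → MvPolynomial (Fin m) k)).det,
        (bordered (algebraMap k _ a) (algebraMap k _ ∘ b ∘ Sum.map Fin.succ id)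
          (algebraMap k _ ∘ b ∘ Sum.map Fin.succ id)
          (pencil (A.submatrix (Sum.map Fin.succ id) (Sum.map Fin.succ id))
            (X : Fin m → MvPolynomial (Fin m) k))).det}) ?_ ?_ ?_,
      c.zeros_det_bordered_pencil, ih, sub_self, zeros_empty_succ]
    · exact hs.submatrix _
    · exact hA
    · exact hA
    · intro K _ _ t x
      simp only [Set.mem_insert_iff, Set.mem_singleton_iff, forall_eq_or_imp, forall_eq,
        Fin.forall_fin_two, cons_val_zero, cons_val_one, det_bordered_pencil_map, det_pencil_map,
        aeval_comp_X, aeval_comp_cons]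
      rw [det_bordered_pencil_cons, det_pencil_cons]
      rfl
    · intro K _ _ x
      simp only [Set.mem_singleton_iff, forall_eq, Fin.forall_fin_two, cons_val_zero, cons_val_one,
        det_bordered_pencil_map, det_pencil_map, aeval_comp_X, aeval_comp_cons]
      have h := det_bordered_pencil_mul_det (algebraMap k K a) (algebraMap k K ∘ b) hs x
      simp only [Function.comp_assoc, Function.comp_apply] at h
      constructor
      · intro h0
        rw [h0] at h
        refine ⟨⟨trivial, ?_⟩, ?_, trivial⟩
        · linear_combination h
        · linear_combination -h
      · rintro ⟨⟨-, h1⟩, -⟩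
        apply pow_eq_zero_iff (two_ne_zero) |>.mp
        linear_combination h - h1
    · intro K _ _ x
      simp [Fin.forall_fin_two]

/-- The leading coefficients form the adjugate of the smaller pencil. The coefficients are
proportional exactly on the locus treated in `zeros_det_pencil_pair`. -/
theorem zeros_adjugate_pencil {m : ℕ} {A : Matrix (Fin m ⊕ l) (Fin m ⊕ l) k} (hs : A.IsSymm)
    (hA : (A.submatrix Sum.inr Sum.inr).adjugate = 0) :
    c.zeros (Set.range fun p : (Fin m ⊕ l) × (Fin m ⊕ l) =>
      (pencil A (X : Fin m → MvPolynomial (Fin m) k)).adjugate p.1 p.2) =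
      c.zeros (∅ : Set (MvPolynomial (Fin m) k)) := by
  induction m with
  | zero =>
    rw [(det_bordered_pencil_zero 0 0 0 hA _).1]
    refine c.zeros_congr fun K _ _ x => ?_
    simp
  | succ m ih =>
    have hB : ∀ (K : Type u) [Field K] [Algebra k K] (x : Fin m → K) p q,
        aeval x (fromBlocks (0 : Matrix Unit Unit _) 0 0
          (pencil (A.submatrix (Sum.map Fin.succ id) (Sum.map Fin.succ id))
            (X : Fin m → MvPolynomial (Fin m) k)).adjugate p q) =
          fromBlocks (0 : Matrix Unit Unit K) 0 0
            (pencil (A.submatrix (Sum.map Fin.succ id) (Sum.map Fin.succ id)) x).adjugate p q := by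
      rintro K _ _ x (p | p) (q | q) <;> simp [adjugate_pencil_map, aeval_comp_X]
    rw [c.zeros_succ (ι := (Unit ⊕ (Fin m ⊕ l)) × (Unit ⊕ (Fin m ⊕ l)))
      (fun p => fromBlocks (0 : Matrix Unit Unit _) 0 0
        (pencil (A.submatrix (Sum.map Fin.succ id) (Sum.map Fin.succ id))
          (X : Fin m → MvPolynomial (Fin m) k)).adjugate p.1 p.2)
      (fun p => (pencil A (Fin.cons 0 X : Fin (m + 1) → MvPolynomial (Fin m) k)).adjugate
        (sumSuccEquiv m l p.1) (sumSuccEquiv m l p.2))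
      (T := {(pencil (A.submatrix (Sum.map Fin.succ id) (Sum.map Fin.succ id))
          (X : Fin m → MvPolynomial (Fin m) k)).det,
        (bordered (algebraMap k _ (A (Sum.inl 0) (Sum.inl 0)))
          (algebraMap k _ ∘ fun j => A (Sum.inl 0) (Sum.map Fin.succ id j))
          (algebraMap k _ ∘ fun j => A (Sum.inl 0) (Sum.map Fin.succ id j))
          (pencil (A.submatrix (Sum.map Fin.succ id) (Sum.map Fin.succ id))
            (X : Fin m → MvPolynomial (Fin m) k))).det})
      (U := Set.range fun p : (Fin m ⊕ l) × (Fin m ⊕ l) =>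
        (pencil (A.submatrix (Sum.map Fin.succ id) (Sum.map Fin.succ id))
          (X : Fin m → MvPolynomial (Fin m) k)).adjugate p.1 p.2) ?_ ?_ ?_,
      c.zeros_det_pencil_pair, ih, sub_self, zeros_empty_succ]
    · exact hs.submatrix _
    · exact hA
    · exact hs.submatrix _
    · exact hA
    · intro K _ _ t x
      simp only [Set.forall_mem_range, hB, adjugate_pencil_map, aeval_comp_X, aeval_comp_cons,
        ← adjugate_pencil_cons]
      exact (((sumSuccEquiv m l).prodCongr (sumSuccEquiv m l)).forall_congr_right
        (q := fun p => (pencil A (Fin.cons t x : Fin (m + 1) → K)).adjugate p.1 p.2 = 0)).symm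
    · intro K _ _ x
      have h := adjugate_bordered_proportional_iff (algebraMap k K (A (Sum.inl 0) (Sum.inl 0)))
        (algebraMap k K ∘ fun j => A (Sum.inl 0) (Sum.map Fin.succ id j))
        (pencil_isSymm (hs.submatrix (Sum.map Fin.succ id)) x)
      have hsymm : (algebraMap k K ∘ fun j : Fin m ⊕ l => A (Sum.inl 0) (Sum.map Fin.succ id j)) =
          algebraMap k K ∘ fun j => A (Sum.map Fin.succ id j) (Sum.inl 0) := by
        ext j
        simp [hs.apply]
      have h0 := adjugate_pencil_cons A 0 x
      have hp := pencil_cons A 0 x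
      rw [← hsymm, add_zero] at hp
      have hb : ∀ i j, (pencil A (Fin.cons 0 x : Fin (m + 1) → K)).adjugate (sumSuccEquiv m l i)
          (sumSuccEquiv m l j) = (bordered (algebraMap k K (A (Sum.inl 0) (Sum.inl 0)))
          (algebraMap k K ∘ fun j => A (Sum.inl 0) (Sum.map Fin.succ id j))
          (algebraMap k K ∘ fun j => A (Sum.inl 0) (Sum.map Fin.succ id j))
          (pencil (A.submatrix (Sum.map Fin.succ id) (Sum.map Fin.succ id)) x)).adjugate i j := by
        intro i j
        rw [← hp, adjugate_submatrix_equiv_self, submatrix_apply]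
      simp only [Set.mem_insert_iff, Set.mem_singleton_iff, forall_eq_or_imp, forall_eq,
        det_bordered_pencil_map, det_pencil_map, adjugate_pencil_map, aeval_comp_X, hB,
        aeval_comp_cons, hb, Prod.forall]
      exact h.symm
    · intro K _ _ x
      simp only [Set.forall_mem_range, hB, adjugate_pencil_map, aeval_comp_X]
      refine ⟨fun h => ?_, fun h p => h (Sum.inr p.1, Sum.inr p.2)⟩
      rintro ⟨p | p, q | q⟩
      · rfl
      · rfl
      · rfl
      · exact h (p, q)

/-- The locus of corank at least two of a symmetric pencil of matrices. -/
theorem zeros_adjugate_pencil_eq_zero {m : ℕ} (hm : m ≠ 0)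
    {A : Matrix (Fin m ⊕ l) (Fin m ⊕ l) k} (hs : A.IsSymm)
    (hA : (A.submatrix Sum.inr Sum.inr).adjugate = 0) :
    c.zeros (Set.range fun p : (Fin m ⊕ l) × (Fin m ⊕ l) =>
      (pencil A (X : Fin m → MvPolynomial (Fin m) k)).adjugate p.1 p.2) = 0 := by
  obtain ⟨m, rfl⟩ := Nat.exists_eq_succ_of_ne_zero hm
  rw [c.zeros_adjugate_pencil hs hA]
  exact c.zeros_empty_succ m

end AffineInvariant

/-! ### The class in the Grothendieck ring modulo the Lefschetz class -/

namespace VarOver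

variable {k : Type u} [Field k] {A B : Type u} [CommRing A] [Algebra k A] [Algebra.FiniteType k A]
  [CommRing B] [Algebra k B] [Algebra.FiniteType k B]

/-- The morphism of affine varieties given by a homomorphism of algebras. -/
noncomputable def specMap (f : A →ₐ[k] B) : (spec k B).1 ⟶ (spec k A).1 :=
  Over.homMk (Spec.map (CommRingCat.ofHom f.toRingHom)) (by
    change Spec.map _ ≫ Spec.map _ = Spec.map _
    rw [← Spec.map_comp, ← CommRingCat.ofHom_comp]
    congr 2
    exact f.comp_algebraMap)

theorem toK0_spec_congr (e : A ≃ₐ[k] B) : (spec k A).toK0 = (spec k B).toK0 := by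
  refine Ideal.Quotient.eq.mpr (Ideal.subset_span (K0Rel.iso _ _ ⟨specMap e.symm.toAlgHom,
    specMap e.toAlgHom, ?_, ?_⟩))
  · apply Over.OverMorphism.ext
    change Spec.map _ ≫ Spec.map _ = 𝟙 _
    rw [← Spec.map_comp, ← CommRingCat.ofHom_comp, ← Spec.map_id]
    congr 1
    ext x
    simp
  · apply Over.OverMorphism.ext
    change Spec.map _ ≫ Spec.map _ = 𝟙 _
    rw [← Spec.map_comp, ← CommRingCat.ofHom_comp, ← Spec.map_id]
    congr 1
    ext x
    simp

theorem toK0_spec_scissor (I : Ideal A) (f : A)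
    (h : PrimeSpectrum.zeroLocus (I : Set A) = PrimeSpectrum.zeroLocus {f}) :
    (spec k A).toK0 = (spec k (A ⧸ I)).toK0 + (spec k (Localization.Away f)).toK0 := by
  rw [toK0, toK0, toK0, ← map_add]
  refine Ideal.Quotient.eq.mpr (Ideal.subset_span (K0Rel.scissor _ _ _
    (specMap (Ideal.Quotient.mkₐ k I)) (specMap (IsScalarTower.toAlgHom k A (Localization.Away f)))
    ?_ ?_ ?_))
  · exact IsClosedImmersion.spec_of_surjective _ Ideal.Quotient.mk_surjective
  · exact inferInstanceAs (IsOpenImmersion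
      (Spec.map (CommRingCat.ofHom (algebraMap A (Localization.Away f)))))
  · have h1 := PrimeSpectrum.localization_away_comap_range (Localization.Away f) f
    have h2 := range_comap_of_surjective _ (Ideal.Quotient.mk I)
      Ideal.Quotient.mk_surjective
    rw [Ideal.mk_ker, h] at h2
    rw [PrimeSpectrum.basicOpen_eq_zeroLocus_compl, ← h2] at h1
    exact h1

/-- `A[t]` is the pushout of `A` and `k[t]` over `k`, so its spectrum is a product with the affine
line. -/
theorem toK0_spec_polynomial :
    (spec k (Polynomial A)).toK0 = (spec k A).toK0 * lefschetz k := by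
  let _ : Algebra (Polynomial k) (Polynomial A) := Polynomial.algebra k A
  rw [toK0, toK0, lefschetz, toK0, ← map_mul]
  refine Ideal.Quotient.eq.mpr (Ideal.subset_span (K0Rel.prod _ _ _
    (specMap (IsScalarTower.toAlgHom k A (Polynomial A)))
    (specMap (Polynomial.mapAlgHom (Algebra.ofId k A))) ?_))
  exact isPullback_SpecMap_of_isPushout _ _ _ _
    (CommRingCat.isPushout_of_isPushout k A (Polynomial k) (Polynomial A))

end VarOver

/-- The class of a variety in the Grothendieck ring modulo the Lefschetz class. -/
noncomputable def AffineInvariant.k0 (k : Type u) [Field k] :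
    AffineInvariant k (K0Var k ⧸ Ideal.span {lefschetz k}) where
  cls A _ _ _ := Ideal.Quotient.mk _ (VarOver.spec k A).toK0
  congr A B _ _ _ _ _ _ e := by rw [VarOver.toK0_spec_congr e]
  scissor A _ _ _ I f h := by rw [VarOver.toK0_spec_scissor I f h, map_add]
  polynomial A _ _ _ := by
    rw [VarOver.toK0_spec_polynomial, Ideal.Quotient.eq_zero_iff_mem]
    exact Ideal.mul_mem_left _ _ (Ideal.subset_span rfl)

/-! ### The number of points modulo the order of the field -/

theorem finite_algHom_of_finiteType (k A : Type*) [Field k] [Finite k] [CommRing A] [Algebra k A]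
    [Algebra.FiniteType k A] : Finite (A →ₐ[k] k) := by
  obtain ⟨n, f, hf⟩ := Algebra.FiniteType.iff_quotient_mvPolynomial''.mp
    (inferInstance : Algebra.FiniteType k A)
  refine Finite.of_injective (fun φ i => φ (f (MvPolynomial.X i)) : (A →ₐ[k] k) → Fin n → k) ?_
  intro φ ψ h
  have h1 : φ.comp f = ψ.comp f := MvPolynomial.algHom_ext fun i => congrFun h i
  ext a
  obtain ⟨p, rfl⟩ := hf a
  exact DFunLike.congr_fun h1 p

/-- Points of `A⧸I` are points of `A` where `I` vanishes. -/
def quotientAlgHomEquiv {k A : Type*} [Field k] [CommRing A] [Algebra k A] (I : Ideal A) :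
    (A ⧸ I →ₐ[k] k) ≃ {φ : A →ₐ[k] k // ∀ a ∈ I, φ a = 0} where
  toFun φ := ⟨φ.comp (Ideal.Quotient.mkₐ k I), fun a ha => by
    simp [Ideal.Quotient.eq_zero_iff_mem.mpr ha]⟩
  invFun φ := Ideal.Quotient.liftₐ I φ.1 φ.2
  left_inv φ := Ideal.Quotient.algHom_ext _ (AlgHom.ext fun a => rfl)
  right_inv φ := Subtype.ext (AlgHom.ext fun a => rfl)

/-- Points of `A` localized at `f` are points of `A` where `f` does not vanish. -/
noncomputable def awayAlgHomEquiv {k A : Type*} [Field k] [CommRing A] [Algebra k A] (f : A) :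
    (Localization.Away f →ₐ[k] k) ≃ {φ : A →ₐ[k] k // φ f ≠ 0} where
  toFun φ := ⟨φ.comp (IsScalarTower.toAlgHom k A (Localization.Away f)),
    ((IsLocalization.Away.algebraMap_isUnit f).map φ).ne_zero⟩
  invFun φ := IsLocalization.liftAlgHom (M := Submonoid.powers f) (f := φ.1) (by
    rintro ⟨_, n, rfl⟩
    simpa using φ.2.isUnit.pow n)
  left_inv φ := IsLocalization.algHom_ext (Submonoid.powers f) (AlgHom.ext fun a =>
    IsLocalization.lift_eq _ a)
  right_inv φ := Subtype.ext (AlgHom.ext fun a => IsLocalization.lift_eq _ a)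

/-- A point of `Spec A[t]` is a point of `Spec A` and a value of `t`. -/
noncomputable def polynomialAlgHomEquiv {k A : Type*} [Field k] [CommRing A] [Algebra k A] :
    (Polynomial A →ₐ[k] k) ≃ (A →ₐ[k] k) × k where
  toFun φ := (φ.comp (IsScalarTower.toAlgHom k A (Polynomial A)), φ Polynomial.X)
  invFun p := Polynomial.eval₂AlgHom p.1 p.2 fun _ => Commute.all _ _
  left_inv φ := by
    refine AlgHom.ext fun p => ?_
    induction p using Polynomial.induction_on' with
    | add p q hp hq => simp only [map_add, hp, hq]
    | monomial n x =>
      rw [← Polynomial.C_mul_X_pow_eq_monomial]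
      simp
  right_inv p := by
    refine Prod.ext (AlgHom.ext fun a => ?_) ?_ <;> simp

/-- The number of `F`-points modulo the order of `F`. -/
noncomputable def AffineInvariant.points (F : Type u) [Field F] [Finite F] :
    AffineInvariant F (ZMod (Nat.card F)) where
  cls A _ _ _ := (Nat.card (A →ₐ[F] F) : ZMod (Nat.card F))
  congr A B _ _ _ _ _ _ e := by rw [Nat.card_congr (e.arrowCongr AlgEquiv.refl)]
  scissor A _ _ _ I f h := by
    have := finite_algHom_of_finiteType F A
    classical
    rw [Nat.card_congr (quotientAlgHomEquiv I), Nat.card_congr (awayAlgHomEquiv f),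
      ← Nat.cast_add, ← Nat.card_sum, ← Nat.card_congr
        (Equiv.sumCompl fun φ : A →ₐ[F] F => φ f = 0)]
    refine congrArg Nat.cast (Nat.card_congr (Equiv.sumCongr (Equiv.subtypeEquivRight fun φ => ?_)
      (Equiv.refl _)))
    have h' := Set.ext_iff.mp h ⟨RingHom.ker φ, RingHom.ker_isPrime _⟩
    simp only [PrimeSpectrum.mem_zeroLocus, Set.singleton_subset_iff, SetLike.mem_coe,
      RingHom.mem_ker] at h'
    exact h'.symm
  polynomial A _ _ _ := by
    rw [Nat.card_congr polynomialAlgHomEquiv, Nat.card_prod]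
    simp

/-! ### The determinant of the incidence pencil -/

namespace Matrix

theorem fromBlocks_diagonal_isSymm {R : Type*} [CommRing R] {l E : Type*}
    [DecidableEq E] (B : Matrix E l R) (x : E → R) :
    (fromBlocks (diagonal x) B Bᵀ 0).IsSymm := by
  rw [IsSymm, fromBlocks_transpose]
  simp

variable {R : Type*} [CommRing R] {n l E : Type*} [Fintype n] [DecidableEq n] [Fintype l]
  [DecidableEq l] [Fintype E] [DecidableEq E]

/-- Expansion of `det (A + diagonal d)` into principal minors of `A`. -/
theorem det_add_diagonal (A : Matrix n n R) (d : n → R) :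
    (A + diagonal d).det =
      ∑ s : Finset n, (∏ i ∈ sᶜ, d i) * (A.toSquareBlockProp (· ∈ s)).det := by
  have h := (detRowAlternating (n := n) (R := R)).map_add_univ A (diagonal d)
  refine h.trans (Finset.sum_congr rfl fun s _ => ?_)
  let N : Matrix n n R := of fun i j => if i ∈ s then A i j else diagonal d i j
  have hN : detRowAlternating (s.piecewise A (diagonal d)) = N.det :=
    congrArg detRowAlternating (by
      ext i j
      by_cases h : i ∈ s <;> simp [N, Finset.piecewise, h])
  rw [hN, twoBlockTriangular_det N (· ∈ s) (fun i hi j hj => by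
    have hij : i ≠ j := by
      rintro rfl
      exact hi hj
    simp [N, hi, hij]), mul_comm]
  have h1 : toSquareBlockProp N (fun i => ¬ i ∈ s) = diagonal fun i => d i.1 := by
    ext i j
    simp [N, toSquareBlockProp_def, diagonal_apply, Subtype.ext_iff, i.2]
  have h2 : toSquareBlockProp N (· ∈ s) = A.toSquareBlockProp (· ∈ s) := by
    ext i j
    simp [N, toSquareBlockProp_def]
  rw [h1, h2, det_diagonal]
  refine congrArg₂ _ (Finset.prod_subtype _ (by simp) d).symm ?_
  congr!

/-- The rows of `B` indexed by `T`. -/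
abbrev rows (B : Matrix E l R) (T : Finset E) : Matrix T l R := B.submatrix Subtype.val id

theorem det_fromBlocks_diagonal (B : Matrix E l R) (x : E → R) :
    (fromBlocks (diagonal x) B Bᵀ 0).det =
      ∑ T : Finset E, (∏ e ∈ Tᶜ, x e) * (fromBlocks 0 (rows B T) (rows B T)ᵀ 0).det := by
  have h : fromBlocks (diagonal x) B Bᵀ 0 =
      fromBlocks 0 B Bᵀ 0 + diagonal (Sum.elim x (0 : l → R)) := by
    rw [← fromBlocks_diagonal, fromBlocks_add]
    simp
  rw [h, det_add_diagonal]
  symm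
  refine Finset.sum_of_injOn (fun T => T.disjSum Finset.univ) ?_ (by simp) ?_ ?_
  · intro T _ T' _ hT
    ext e
    simpa using Finset.ext_iff.mp hT (Sum.inl e)
  · intro s _ hs
    -- A principal minor omitting a vertex index is multiplied by a zero entry of the added
    -- diagonal.
    obtain ⟨v, hv⟩ : ∃ v : l, Sum.inr v ∉ s := by
      by_contra! hh
      refine hs ⟨s.preimage Sum.inl Sum.inl_injective.injOn, by simp, ?_⟩
      ext (e | v) <;> simp [hh]
    rw [Finset.prod_eq_zero (i := Sum.inr v) (by simpa using hv) (by simp), zero_mul]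
  · intro T _
    congr 1
    · have : (T.disjSum (Finset.univ : Finset l))ᶜ = Tᶜ.map Function.Embedding.inl := by
        ext (e | v) <;> simp
      rw [this, Finset.prod_map]
      simp
    · let f : T ⊕ l ≃ {i : E ⊕ l // i ∈ T.disjSum (Finset.univ : Finset l)} :=
        Equiv.ofBijective
          (Sum.elim (fun e => ⟨Sum.inl e.1, by simp⟩) fun v => ⟨Sum.inr v, by simp⟩) (by
            constructor
            · rintro (a | a) (b | b) h
              · exact congrArg Sum.inl (Subtype.ext (Sum.inl_injective (Subtype.ext_iff.mp h)))
              · exact absurd (Subtype.ext_iff.mp h) Sum.inl_ne_inr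
              · exact absurd (Subtype.ext_iff.mp h) Sum.inr_ne_inl
              · exact congrArg Sum.inr (Sum.inr_injective (Subtype.ext_iff.mp h))
            · rintro ⟨a | a, ha⟩
              · exact ⟨Sum.inl ⟨a, by simpa using ha⟩, rfl⟩
              · exact ⟨Sum.inr a, rfl⟩)
      rw [← det_submatrix_equiv_self f]
      refine congrArg det ?_
      ext (a | a) (b | b) <;> rfl

theorem det_fromBlocks_zero_zero_square (B C : Matrix n n R) :
    (fromBlocks 0 B C 0).det = (-1) ^ Fintype.card n * (B.det * C.det) := by
  have h : fromBlocks 0 B C 0 * fromBlocks 0 1 (-1) 0 = fromBlocks (-B) 0 0 C := by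
    rw [fromBlocks_multiply]; simp
  -- A product of three shears, hence of determinant one.
  have h1 : (fromBlocks 0 1 (-1) 0 : Matrix (n ⊕ n) (n ⊕ n) R) =
      fromBlocks 1 1 0 1 * fromBlocks 1 0 (-1) 1 * fromBlocks 1 1 0 1 := by
    simp [fromBlocks_multiply]
  have h2 := congrArg det h
  rw [det_mul, h1, det_mul, det_mul] at h2
  simpa [det_neg, mul_assoc] using h2

/-- Mutually inverse integer matrices are square with determinant `±1`. That sign is squared away
here, which is why all spanning trees contribute equally. -/
theorem det_fromBlocks_zero_transpose {T : Type*} [Fintype T] [DecidableEq T] {B : Matrix T l ℤ}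
    {P : Matrix l T ℤ} (hBP : B * P = 1) (hPB : P * B = 1) :
    (fromBlocks 0 B Bᵀ 0).det = (-1) ^ Fintype.card l := by
  let e : l ≃ T := Fintype.equivOfCardEq (square_of_invertible P B hPB hBP)
  have h1 : (fromBlocks 0 B Bᵀ 0).submatrix (Equiv.sumCongr e (Equiv.refl l))
      (Equiv.sumCongr e (Equiv.refl l)) =
        fromBlocks 0 (B.submatrix e id) (B.submatrix e id)ᵀ 0 := by
    ext (i | i) (j | j) <;> rfl
  have h2 : (P.submatrix id e * B.submatrix e id).det = 1 := by
    have := submatrix_mul_equiv P B id e id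
    rw [this, hPB]
    simp
  rw [det_mul] at h2
  have h3 : IsUnit (B.submatrix e id).det := IsUnit.of_mul_eq_one _ ((mul_comm _ _).trans h2)
  rw [← det_submatrix_equiv_self (Equiv.sumCongr e (Equiv.refl l)), h1,
    det_fromBlocks_zero_zero_square, det_transpose, Int.isUnit_mul_self h3, mul_one]

/-- The determinant is affine linear in `x e`, with slope the principal minor that omits `e`. -/
theorem det_fromBlocks_update_sub (B : Matrix E l R) (x : E → R) (e : E) :
    (fromBlocks (diagonal (Function.update x e 1)) B Bᵀ 0).det -
      (fromBlocks (diagonal (Function.update x e 0)) B Bᵀ 0).det =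
      (fromBlocks (diagonal x) B Bᵀ 0).adjugate (Sum.inl e) (Sum.inl e) := by
  have h : ∀ t, fromBlocks (diagonal (Function.update x e t)) B Bᵀ 0 =
      (fromBlocks (diagonal x) B Bᵀ 0).updateRow (Sum.inl e)
        (Sum.elim (0 : E → R) (B e) + t • Pi.single (Sum.inl e) 1) := by
    intro t
    ext (i | i) (j | j)
    · by_cases hi : i = e
      · subst hi
        by_cases hj : j = i
        · subst hj; simp
        · simp [hj, diagonal_apply_ne' _ hj]
      · by_cases hj : i = j
        · subst hj; simp [updateRow_apply, hi]
        · simp [updateRow_apply, hi, hj]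
    · by_cases hi : i = e
      · subst hi; simp
      · simp [updateRow_apply, hi]
    · simp [updateRow_apply]
    · simp [updateRow_apply]
  rw [h, h, det_updateRow_add, det_updateRow_add, det_updateRow_smul, det_updateRow_smul,
    adjugate_apply]
  ring

/-- If `B` has a left inverse, the singular symmetric matrix `fromBlocks (diagonal x) B Bᵀ 0` has
corank at least two as soon as its first principal minors of corank one vanish. -/
theorem adjugate_fromBlocks_eq_zero {F : Type*} [Field F] {B : Matrix E l F} {P : Matrix l E F}
    (hP : P * B = 1) {x : E → F} (hdet : (fromBlocks (diagonal x) B Bᵀ 0).det = 0)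
    (hadj : ∀ e, (fromBlocks (diagonal x) B Bᵀ 0).adjugate (Sum.inl e) (Sum.inl e) = 0) :
    (fromBlocks (diagonal x) B Bᵀ 0).adjugate = 0 := by
  obtain ⟨w, hw, hNw⟩ := exists_mulVec_eq_zero_iff.mpr hdet
  obtain ⟨a, ha⟩ :=
    exists_adjugate_eq_smul_vecMulVec (fromBlocks_diagonal_isSymm B x) hw hNw
  by_cases ha0 : a = 0
  · simp [ha, ha0]
  exfalso
  -- The diagonal entries of the adjugate are `a * w e ^ 2`. Once they vanish, `B` kills the rest of
  -- `w`, which contradicts the left inverse.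
  have hwe : ∀ e, w (Sum.inl e) = 0 := fun e => by
    have := hadj e
    rw [ha] at this
    simpa [vecMulVec_apply, ha0] using this
  have hB : B *ᵥ (w ∘ Sum.inr) = 0 := by
    rw [fromBlocks_mulVec] at hNw
    have h0 : w ∘ Sum.inl = 0 := funext hwe
    ext e
    simpa [h0] using congrFun hNw (Sum.inl e)
  have h1 : w ∘ Sum.inr = 0 := by
    have := congrArg (P *ᵥ ·) hB
    simpa [hP] using this
  exact hw (funext (Sum.rec hwe (congrFun h1)))

end Matrix

/-! ### The incidence matrix of a graph -/

namespace Graph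

open Relation

variable {α β : Type*} (G : Graph α β)

theorem exists_isLink (e : G.edgeSet) : ∃ a b, G.IsLink e a b :=
  (G.edge_mem_iff_exists_isLink e).mp e.2

/-- The first end of an edge, for a chosen orientation. -/
noncomputable def src (e : G.edgeSet) : α := (G.exists_isLink e).choose

/-- The second end of an edge, for a chosen orientation. -/
noncomputable def tgt (e : G.edgeSet) : α := (G.exists_isLink e).choose_spec.choose

theorem isLink_src_tgt (e : G.edgeSet) : G.IsLink e (G.src e) (G.tgt e) :=
  (G.exists_isLink e).choose_spec.choose_spec

open Classical in
/-- The incidence number of an edge and a vertex. -/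
noncomputable def incidence (e : G.edgeSet) (v : α) : ℤ :=
  (if G.src e = v then 1 else 0) - (if G.tgt e = v then 1 else 0)

variable {G}

theorem reflTransGen_isLink_symm {T : Set β} {a b : α}
    (h : ReflTransGen (fun a b => ∃ e ∈ T, G.IsLink e a b) a b) :
    ReflTransGen (fun a b => ∃ e ∈ T, G.IsLink e a b) b a := by
  induction h with
  | refl => exact .refl
  | tail _ h ih =>
    obtain ⟨e, he, hl⟩ := h
    exact ReflTransGen.head ⟨e, he, hl.symm⟩ ih

-- The signed sum of the edges along a path, each counted according to its chosen orientation, has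
-- boundary `a - b`.
open Classical in
theorem exists_flow [Fintype G.edgeSet] {T : Set G.edgeSet} {a b : α}
    (h : ReflTransGen (fun a b => ∃ e ∈ Subtype.val '' T, G.IsLink e a b) a b) :
    ∃ p : G.edgeSet → ℤ, (∀ e ∉ T, p e = 0) ∧ ∀ v, ∑ e, p e * G.incidence e v =
      (if a = v then 1 else 0) - (if b = v then 1 else 0) := by
  induction h with
  | refl => exact ⟨0, by simp, by simp⟩
  | @tail b c _ h ih =>
    obtain ⟨p, hp, hpv⟩ := ih
    obtain ⟨_, ⟨e, he, rfl⟩, hl⟩ := h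
    obtain ⟨s, hs⟩ : ∃ s : ℤ, ∀ v, s * G.incidence e v =
        (if b = v then 1 else 0) - (if c = v then 1 else 0) := by
      rcases hl.eq_and_eq_or_eq_and_eq (G.isLink_src_tgt e) with ⟨rfl, rfl⟩ | ⟨rfl, rfl⟩
      · exact ⟨1, fun v => by simp [incidence]⟩
      · exact ⟨-1, fun v => by simp [incidence]⟩
    refine ⟨p + Pi.single e s, fun f hf => ?_, fun v => ?_⟩
    · have : f ≠ e := by rintro rfl; exact hf he
      simp [hp f hf, this]
    · simp only [Pi.add_apply, add_mul, Finset.sum_add_distrib, hpv]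
      rw [Finset.sum_eq_single e (fun f _ hf => by simp [hf]) (by simp), Pi.single_eq_same, hs]
      ring

variable {r : α} [Fintype {v // v ∈ G.vertexSet ∧ v ≠ r}]

theorem sum_incidence_mul (e : G.edgeSet) (f : α → ℤ) (hf : f r = 0) :
    ∑ v : {v // v ∈ G.vertexSet ∧ v ≠ r}, G.incidence e v * f v = f (G.src e) - f (G.tgt e) := by
  classical
  have h : ∀ a ∈ G.vertexSet, ∑ v : {v // v ∈ G.vertexSet ∧ v ≠ r},
      (if a = v then 1 else 0) * f v = f a := by
    intro a ha
    by_cases har : a = r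
    · subst har
      rw [hf]
      exact Finset.sum_eq_zero fun v _ => by simp [v.2.2.symm]
    · rw [Finset.sum_eq_single ⟨a, ha, har⟩ (fun v _ hv => ?_) (by simp)]
      · simp
      · have : a ≠ v := fun h => hv (Subtype.ext h.symm)
        simp [this]
  simp only [incidence, sub_mul, Finset.sum_sub_distrib]
  rw [h _ (G.isLink_src_tgt e).left_mem, h _ (G.isLink_src_tgt e).right_mem]

/-- Removing a tree edge `e` separates its ends. Pairing the flow with the indicator of one side
leaves only the contribution of `e`, so its coefficient is zero. -/
theorem eq_zero_of_flow [Fintype G.edgeSet] {T : Set G.edgeSet}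
    (hT : G.IsSpanningTree (Subtype.val '' T)) {y : G.edgeSet → ℤ} (hy : ∀ e ∉ T, y e = 0)
    (hf : ∀ v : {v // v ∈ G.vertexSet ∧ v ≠ r}, ∑ e, y e * G.incidence e v = 0) : y = 0 := by
  classical
  ext e
  by_contra hne
  have he : e ∈ T := by
    by_contra h
    exact hne (hy e h)
  let J : α → Prop := fun v =>
    ReflTransGen (fun a b => ∃ f ∈ Subtype.val '' T \ {e.1}, G.IsLink f a b) (G.src e) v
  -- Subtracting a constant makes `g` vanish at `r`, where conservation of the flow is not assumed.
  let g : α → ℤ := fun v => (if J v then 1 else 0) - (if J r then 1 else 0)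
  have h1 : ∑ f, y f * (g (G.src f) - g (G.tgt f)) = 0 := by
    simp only [← sum_incidence_mul (r := r) _ g (by simp [g]), Finset.mul_sum]
    rw [Finset.sum_comm]
    refine Finset.sum_eq_zero fun v _ => ?_
    simp only [← mul_assoc]
    rw [← Finset.sum_mul, hf v, zero_mul]
  rw [Finset.sum_eq_single e _ (by simp)] at h1
  · have hs : J (G.src e) := ReflTransGen.refl
    have ht : ¬ J (G.tgt e) :=
      hT.acyclic e (Set.mem_image_of_mem _ he) _ _ (G.isLink_src_tgt e)
    simp [g, hs, ht] at h1
    exact hne h1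
  · intro f _ hfe
    by_cases hfT : f ∈ T
    · have hfe' : f.1 ∈ Subtype.val '' T \ {e.1} :=
        ⟨Set.mem_image_of_mem _ hfT, fun h => hfe (Subtype.ext h)⟩
      have : J (G.src f) ↔ J (G.tgt f) :=
        ⟨fun h => h.tail ⟨f, hfe', G.isLink_src_tgt f⟩,
          fun h => h.tail ⟨f, hfe', (G.isLink_src_tgt f).symm⟩⟩
      simp [g, this]
    · simp [hy f hfT]

variable (G r) in
/-- The incidence matrix of `G` without the column of the vertex `r`. -/
noncomputable def reducedIncidence : Matrix G.edgeSet {v // v ∈ G.vertexSet ∧ v ≠ r} ℤ :=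
  Matrix.of fun e v => G.incidence e v

open Matrix

theorem sum_subtype_eq {E : Type*} [Fintype E] {T : Finset E} {f : E → ℤ}
    (hf : ∀ e ∉ T, f e = 0) : ∑ e : T, f e = ∑ e, f e := by
  rw [Finset.sum_coe_sort T f]
  exact Finset.sum_subset (Finset.subset_univ _) fun e _ he => hf e he

/-- Row `v` of the inverse is the flow along the tree path from `v` to the root. This gives one
product directly; the other differs from the identity by flows without boundary, which vanish on a
tree. -/
theorem exists_inverse_of_isSpanningTree [Fintype G.edgeSet] [DecidableEq G.edgeSet]
    [DecidableEq {v // v ∈ G.vertexSet ∧ v ≠ r}] (hr : r ∈ G.vertexSet) {T : Finset G.edgeSet}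
    (hT : G.IsSpanningTree (Subtype.val '' (T : Set G.edgeSet))) :
    ∃ P : Matrix {v // v ∈ G.vertexSet ∧ v ≠ r} T ℤ,
      rows (G.reducedIncidence r) T * P = 1 ∧ P * rows (G.reducedIncidence r) T = 1 := by
  classical
  choose p hp hpv using fun v : {v // v ∈ G.vertexSet ∧ v ≠ r} =>
    exists_flow (hT.connected v v.2.1 r hr)
  have hpw : ∀ v w : {v // v ∈ G.vertexSet ∧ v ≠ r},
      ∑ e, p v e * G.incidence e w = if v = w then 1 else 0 := by
    intro v w
    simp [hpv, w.2.2.symm, Subtype.ext_iff]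
  refine ⟨of fun v e => p v e, ?_, ?_⟩
  · ext i j
    have h := eq_zero_of_flow (r := r) hT
      (y := fun f => (∑ v : {v // v ∈ G.vertexSet ∧ v ≠ r}, G.incidence i v * p v f) - if i.1 = f then 1 else 0)
      (fun f hf => by
        have : i.1 ≠ f := by rintro rfl; exact hf i.2
        simp [hp _ f hf, this])
      (fun w => by
        simp only [sub_mul, Finset.sum_sub_distrib, Finset.sum_mul]
        rw [Finset.sum_comm]
        simp only [mul_assoc, ← Finset.mul_sum, hpw]
        simp)
    have := congrFun h j
    simp only [Pi.zero_apply, sub_eq_zero] at this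
    rw [mul_apply, one_apply]
    refine Eq.trans ?_ (this.trans (if_congr Subtype.ext_iff.symm rfl rfl))
    rfl
  · ext v w
    rw [mul_apply, one_apply, ← hpw v w]
    exact sum_subtype_eq (f := fun e => p v e * G.incidence e w) fun e he => by
      simp [hp v e he]

/-- A kernel vector is exhibited. If `T` connects every vertex to `r`, it contains a cycle, whose
circulation is killed by `Bᵀ`. Otherwise the indicator of the vertices not reached from `r` is
constant along `T` and killed by `B`. -/
theorem det_eq_zero_of_not_isSpanningTree [Fintype G.edgeSet] [DecidableEq G.edgeSet]
    [DecidableEq {v // v ∈ G.vertexSet ∧ v ≠ r}] (hr : r ∈ G.vertexSet) {T : Finset G.edgeSet}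
    (hT : ¬ G.IsSpanningTree (Subtype.val '' (T : Set G.edgeSet))) :
    (fromBlocks 0 (rows (G.reducedIncidence r) T) (rows (G.reducedIncidence r) T)ᵀ 0).det = 0 := by
  classical
  rw [← exists_mulVec_eq_zero_iff]
  by_cases hc : ∀ v ∈ G.vertexSet,
      ReflTransGen (fun a b => ∃ e ∈ Subtype.val '' (T : Set G.edgeSet), G.IsLink e a b) r v
  · have hac : ∃ e ∈ Subtype.val '' (T : Set G.edgeSet), ∃ x y, G.IsLink e x y ∧
        ReflTransGen (fun a b => ∃ f ∈ Subtype.val '' (T : Set G.edgeSet) \ {e},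
          G.IsLink f a b) x y := by
      by_contra! hh
      exact hT ⟨by rintro _ ⟨e, -, rfl⟩; exact e.2, ⟨r, hr⟩,
        fun x hx y hy => (reflTransGen_isLink_symm (hc x hx)).trans (hc y hy), hh⟩
    obtain ⟨_, ⟨e, he, rfl⟩, x, y, hl, hxy⟩ := hac
    have himg : Subtype.val '' (T : Set G.edgeSet) \ {e.1} =
        Subtype.val '' ((T : Set G.edgeSet) \ {e}) := by
      rw [Set.image_sdiff Subtype.val_injective, Set.image_singleton]
    rw [himg] at hxy
    obtain ⟨p, hp, hpv⟩ := exists_flow hxy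
    obtain ⟨s, hs0, hs⟩ : ∃ s : ℤ, s ≠ 0 ∧ ∀ v, s * G.incidence e v =
        (if x = v then 1 else 0) - (if y = v then 1 else 0) := by
      rcases hl.eq_and_eq_or_eq_and_eq (G.isLink_src_tgt e) with ⟨rfl, rfl⟩ | ⟨rfl, rfl⟩
      · exact ⟨1, by simp, fun v => by simp [incidence]⟩
      · exact ⟨-1, by simp, fun v => by simp [incidence]⟩
    let z : G.edgeSet → ℤ := p - Pi.single e s
    have hze : z e ≠ 0 := by simp [z, hp e (by simp), hs0]
    have hz : ∀ v, ∑ f, z f * G.incidence f v = 0 := by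
      intro v
      simp only [z, Pi.sub_apply, sub_mul, Finset.sum_sub_distrib, hpv]
      rw [Finset.sum_eq_single e (fun f _ hf => by simp [hf]) (by simp), Pi.single_eq_same, hs,
        sub_self]
    have hzT : ∀ f ∉ T, z f = 0 := by
      intro f hf
      have hfe : f ≠ e := by rintro rfl; exact hf he
      simp [z, hfe, hp f (fun h => hf h.1)]
    refine ⟨Sum.elim (fun f => z f) 0, fun h => hze (congrFun h (Sum.inl ⟨e, he⟩)), ?_⟩
    rw [fromBlocks_mulVec]
    ext (f | v)
    · simp
    · simp only [Sum.elim_comp_inl, Sum.elim_comp_inr, Sum.elim_inr, mulVec_zero, add_zero,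
        Pi.zero_apply, mulVec, dotProduct]
      rw [← hz v, ← sum_subtype_eq (f := fun f => z f * G.incidence f v) fun f hf => by
        simp [hzT f hf]]
      exact Finset.sum_congr rfl fun f _ => mul_comm _ _
  · push Not at hc
    obtain ⟨v, hv, hrv⟩ := hc
    let g : α → ℤ := fun v => if ReflTransGen (fun a b =>
      ∃ e ∈ Subtype.val '' (T : Set G.edgeSet), G.IsLink e a b) r v then 0 else 1
    have hvr : v ≠ r := by rintro rfl; exact hrv .refl
    have hgr : g r = 0 := if_pos .refl
    refine ⟨Sum.elim 0 fun v => g v, fun h => ?_, ?_⟩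
    · have := congrFun h (Sum.inr ⟨v, hv, hvr⟩)
      exact one_ne_zero ((if_neg hrv).symm.trans this)
    · rw [fromBlocks_mulVec]
      ext (e | v)
      · simp only [Sum.elim_comp_inl, Sum.elim_comp_inr, Sum.elim_inl, mulVec_zero, zero_add,
          Pi.zero_apply, mulVec, dotProduct]
        refine (sum_incidence_mul e.1 g hgr).trans ?_
        have hl := G.isLink_src_tgt e.1
        have he : e.1.1 ∈ Subtype.val '' (T : Set G.edgeSet) := ⟨e.1, e.2, rfl⟩
        have : ReflTransGen (fun a b => ∃ e ∈ Subtype.val '' (T : Set G.edgeSet),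
            G.IsLink e a b) r (G.src e.1) ↔ ReflTransGen (fun a b =>
            ∃ e ∈ Subtype.val '' (T : Set G.edgeSet), G.IsLink e a b) r (G.tgt e.1) :=
          ⟨fun h => h.tail ⟨_, he, hl⟩, fun h => h.tail ⟨_, he, hl.symm⟩⟩
        simp only [g, this, sub_self]
      · simp

/-- The matrix-tree theorem. -/
theorem det_reducedIncidence_eq_aeval_psi [Fintype G.edgeSet] [DecidableEq G.edgeSet]
    [DecidableEq {v // v ∈ G.vertexSet ∧ v ≠ r}] (hr : r ∈ G.vertexSet) {R : Type*} [CommRing R]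
    (x : G.edgeSet → R) :
    (fromBlocks (diagonal x) ((G.reducedIncidence r).map (Int.castRingHom R))
      ((G.reducedIncidence r).map (Int.castRingHom R))ᵀ 0).det =
      (-1) ^ Fintype.card {v // v ∈ G.vertexSet ∧ v ≠ r} * MvPolynomial.aeval x G.psi := by
  classical
  rw [det_fromBlocks_diagonal, psi, map_sum, Finset.mul_sum, Finset.sum_filter]
  refine Fintype.sum_equiv Fintype.finsetEquivSet _ _ fun T => ?_
  have h1 : (fromBlocks 0 (rows ((G.reducedIncidence r).map (Int.castRingHom R)) T)
      (rows ((G.reducedIncidence r).map (Int.castRingHom R)) T)ᵀ 0).det =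
      Int.castRingHom R (fromBlocks 0 (rows (G.reducedIncidence r) T)
        (rows (G.reducedIncidence r) T)ᵀ 0).det := by
    rw [RingHom.map_det, RingHom.mapMatrix_apply, fromBlocks_map]
    refine congrArg det ?_
    ext (i | i) (j | j) <;> simp
  have h2 : Fintype.finsetEquivSet T = (T : Set G.edgeSet) := rfl
  rw [h1, h2]
  split_ifs with hT
  · obtain ⟨P, hP, hP'⟩ := exists_inverse_of_isSpanningTree hr hT
    rw [det_fromBlocks_zero_transpose hP hP', map_prod, mul_comm]
    simp only [map_pow, map_neg, map_one, MvPolynomial.aeval_X]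
    congr 2
    ext e
    simp
  · rw [det_eq_zero_of_not_isSpanningTree hr hT, map_zero, mul_zero]

end Graph

/-! ### The singular locus as a corank locus. -/

open MvPolynomial in
theorem aeval_pderiv_prod_X {σ R : Type*} [DecidableEq σ] [CommRing R] (x : σ → R) (e : σ)
    (s : Finset σ) : aeval x (pderiv e (∏ f ∈ s, X f : MvPolynomial σ ℤ)) =
      ∏ f ∈ s, Function.update x e 1 f - ∏ f ∈ s, Function.update x e 0 f := by
  induction s using Finset.induction_on with
  | empty => simp
  | insert a s ha ih =>
    rw [Finset.prod_insert ha, Finset.prod_insert ha, Finset.prod_insert ha, pderiv_mul, map_add,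
      map_mul, map_mul, ih]
    by_cases hae : a = e
    · subst hae
      have h : ∀ t, ∏ f ∈ s, Function.update x a t f = ∏ f ∈ s, x f := fun t =>
        Finset.prod_congr rfl fun f hf => by
          rw [Function.update_of_ne]
          rintro rfl
          exact ha hf
      simp [h]
    · simp [pderiv_X_of_ne hae, hae, mul_sub]

namespace Graph

open MvPolynomial Matrix

variable {α β : Type*} {G : Graph α β} [Fintype G.edgeSet]

/-- Every monomial of `G.psi` has degree at most one in each variable, so a partial derivative is a
finite difference. -/
theorem aeval_pderiv_psi {R : Type*} [CommRing R] [DecidableEq G.edgeSet] (x : G.edgeSet → R)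
    (e : G.edgeSet) : aeval x (pderiv e G.psi) =
      aeval (Function.update x e 1) G.psi - aeval (Function.update x e 0) G.psi := by
  simp only [psi, map_sum, aeval_pderiv_prod_X, Finset.sum_sub_distrib, map_prod, aeval_X]

theorem forall_mem_singEqs_iff {R : Type*} [CommRing R] (x : G.edgeSet → R) :
    (∀ f ∈ G.singEqs, aeval x f = 0) ↔ aeval x G.psi = 0 ∧ ∀ e, aeval x (pderiv e G.psi) = 0 := by
  rw [singEqs]
  simp only [Set.mem_union, Set.mem_singleton_iff, or_imp, forall_and, forall_eq,
    Set.forall_mem_range]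

/-- The singular locus is the locus where the incidence matrix has corank at least two. -/
theorem forall_mem_singEqs_iff_adjugate_eq_zero [DecidableEq G.edgeSet] {r : α}
    (hr : r ∈ G.vertexSet) [Fintype {v // v ∈ G.vertexSet ∧ v ≠ r}]
    [DecidableEq {v // v ∈ G.vertexSet ∧ v ≠ r}] [Nonempty {v // v ∈ G.vertexSet ∧ v ≠ r}]
    {T : Finset G.edgeSet} (hT : G.IsSpanningTree (Subtype.val '' (T : Set G.edgeSet)))
    {K : Type*} [Field K] (x : G.edgeSet → K) :
    (∀ f ∈ G.singEqs, aeval x f = 0) ↔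
      (fromBlocks (diagonal x) ((G.reducedIncidence r).map (Int.castRingHom K))
        ((G.reducedIncidence r).map (Int.castRingHom K))ᵀ 0).adjugate = 0 := by
  set N := fromBlocks (diagonal x) ((G.reducedIncidence r).map (Int.castRingHom K))
    ((G.reducedIncidence r).map (Int.castRingHom K))ᵀ 0 with hN
  have hs : ((-1) ^ Fintype.card {v // v ∈ G.vertexSet ∧ v ≠ r} : K) ≠ 0 :=
    pow_ne_zero _ (neg_ne_zero.mpr one_ne_zero)
  have h1 : N.det = 0 ↔ aeval x G.psi = 0 := by
    rw [hN, det_reducedIncidence_eq_aeval_psi hr, mul_eq_zero, or_iff_right hs]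
  have h2 : ∀ e, N.adjugate (Sum.inl e) (Sum.inl e) = 0 ↔ aeval x (pderiv e G.psi) = 0 := by
    intro e
    rw [hN, ← det_fromBlocks_update_sub, det_reducedIncidence_eq_aeval_psi hr,
      det_reducedIncidence_eq_aeval_psi hr, ← mul_sub, ← aeval_pderiv_psi, mul_eq_zero,
      or_iff_right hs]
  rw [forall_mem_singEqs_iff]
  constructor
  · rintro ⟨h3, h4⟩
    obtain ⟨P, -, hP⟩ := exists_inverse_of_isSpanningTree hr hT
    -- The inverse of the tree rows, extended by zero, is a left inverse of the whole reduced
    -- incidence matrix.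
    let P' : Matrix {v // v ∈ G.vertexSet ∧ v ≠ r} G.edgeSet K :=
      of fun v e => if h : e ∈ T then (P v ⟨e, h⟩ : K) else 0
    refine adjugate_fromBlocks_eq_zero (P := P') ?_ (h1.mpr h3) fun e => (h2 e).mpr (h4 e)
    ext v w
    have h5 := congrArg (Int.cast : ℤ → K) (congrFun₂ hP v w)
    rw [mul_apply, Int.cast_sum] at h5
    rw [mul_apply, ← Finset.sum_subset (Finset.subset_univ T) fun e _ he => by simp [P', he],
      ← Finset.sum_coe_sort T]
    refine Eq.trans (Finset.sum_congr rfl fun e _ => ?_) (h5.trans ?_)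
    · simp [P']
    · simp [one_apply]
  · intro h3
    refine ⟨h1.mp ?_, fun e => (h2 e).mp (by rw [h3, Matrix.zero_apply])⟩
    obtain ⟨v⟩ := ‹Nonempty {v // v ∈ G.vertexSet ∧ v ≠ r}›
    have := congrFun₂ (mul_adjugate N) (Sum.inr v) (Sum.inr v)
    simpa [h3] using this.symm

end Graph

/-! ### The value of the singular locus. -/

namespace AffineInvariant

open MvPolynomial Matrix

variable {k : Type u} [Field k] {Q : Type w} [AddCommGroup Q] (c : AffineInvariant k Q)

theorem cls_quotient_eq_zeros {σ : Type} [Finite σ] {m : ℕ} (e : σ ≃ Fin m)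
    (S : Set (MvPolynomial σ k)) :
    c.cls (MvPolynomial σ k ⧸ Ideal.span S) = c.zeros (rename e '' S) :=
  c.congr _ _ (Ideal.quotientEquivAlg _ _ (renameEquiv k e) (by
    rw [Ideal.map_span]
    rfl))

theorem cls_singEqs_eq_zero {α : Type*} {β : Type} (G : Graph α β) [Fintype G.edgeSet]
    (hV : G.vertexSet.Finite) (hV3 : 3 ≤ G.vertexSet.ncard) (hE : G.edgeSet.Nonempty) :
    c.cls (MvPolynomial G.edgeSet k ⧸ Ideal.span (map (Int.castRingHom k) '' G.singEqs)) = 0 := by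
  classical
  let e := Fintype.equivFin G.edgeSet
  have hm : Fintype.card G.edgeSet ≠ 0 := by
    have : Nonempty G.edgeSet := hE.to_subtype
    exact Fintype.card_ne_zero
  rw [c.cls_quotient_eq_zeros e]
  have hpt : ∀ (K : Type u) [Field K] [Algebra k K] (x : Fin (Fintype.card G.edgeSet) → K),
      (∀ s ∈ rename e '' (map (Int.castRingHom k) '' G.singEqs), aeval x s = 0) ↔
        ∀ f ∈ G.singEqs, aeval (x ∘ e) f = 0 := by
    intro K _ _ x
    simp only [Set.forall_mem_image, aeval_rename]
    refine forall₂_congr fun f _ => ?_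
    rw [aeval_def, eval₂_map, aeval_def]
    have : (algebraMap k K).comp (Int.castRingHom k) = algebraMap ℤ K := RingHom.ext_int _ _
    rw [this]
  by_cases hT : ∃ T : Finset G.edgeSet,
      G.IsSpanningTree (Subtype.val '' (T : Set G.edgeSet))
  · obtain ⟨T, hT⟩ := hT
    obtain ⟨r, hr⟩ : G.vertexSet.Nonempty := hT.nonempty
    have hfin : Finite {v // v ∈ G.vertexSet ∧ v ≠ r} := hV.subset fun v hv => hv.1
    have := Fintype.ofFinite {v // v ∈ G.vertexSet ∧ v ≠ r}
    -- This is where three vertices are needed: the zero block on the non-root vertices has size at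
    -- least two, so its adjugate is zero.
    have hnt : Nontrivial {v // v ∈ G.vertexSet ∧ v ≠ r} := by
      have h := Set.ncard_sdiff_singleton_of_mem hr
      have hf : Finite ↑(G.vertexSet \ {r}) := hV.sdiff
      have h' : (G.vertexSet \ {r}).Nontrivial :=
        Set.one_lt_ncard_iff_nontrivial.mp (by omega)
      exact Set.nontrivial_coe_sort.mpr h'
    let B := (G.reducedIncidence r).map (Int.castRingHom k)
    let A : Matrix (Fin (Fintype.card G.edgeSet) ⊕ {v // v ∈ G.vertexSet ∧ v ≠ r})
        (Fin (Fintype.card G.edgeSet) ⊕ {v // v ∈ G.vertexSet ∧ v ≠ r}) k :=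
      fromBlocks 0 (B.submatrix e.symm id) (B.submatrix e.symm id)ᵀ 0
    have hs : A.IsSymm := by
      rw [IsSymm, fromBlocks_transpose, transpose_transpose, transpose_zero, transpose_zero]
    have hA : (A.submatrix Sum.inr Sum.inr).adjugate = 0 := by
      have : A.submatrix Sum.inr Sum.inr = 0 := by ext; rfl
      rw [this, adjugate_zero]
    rw [← c.zeros_adjugate_pencil_eq_zero hm hs hA]
    refine c.zeros_congr fun K _ _ x => ?_
    rw [hpt, Graph.forall_mem_singEqs_iff_adjugate_eq_zero hr hT]
    have hN : fromBlocks (diagonal (x ∘ e)) ((G.reducedIncidence r).map (Int.castRingHom K))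
        ((G.reducedIncidence r).map (Int.castRingHom K))ᵀ 0 =
        (pencil A x).submatrix (Equiv.sumCongr e (Equiv.refl _))
          (Equiv.sumCongr e (Equiv.refl _)) := by
      ext (i | i) (j | j)
      · simp [pencil, A, diagonal_apply]
      · simp [pencil, A, B]
      · simp [pencil, A, B]
      · simp [pencil, A]
    rw [hN, adjugate_submatrix_equiv_self, Set.forall_mem_range]
    simp only [adjugate_pencil_map, aeval_comp_X]
    constructor
    · intro h p
      have := congrFun₂ h ((Equiv.sumCongr e (Equiv.refl _)).symm p.1)
        ((Equiv.sumCongr e (Equiv.refl _)).symm p.2)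
      simpa using this
    · intro h
      ext p q
      exact h (_, _)
  -- Without a spanning tree the singular locus is the whole affine space, of positive dimension
  -- since there is an edge.
  · have hpsi : G.psi = 0 := by
      rw [Graph.psi]
      refine Finset.sum_eq_zero fun T hT' => (hT ⟨T.toFinset, ?_⟩).elim
      simpa using (Finset.mem_filter.mp hT').2
    obtain ⟨m, hm'⟩ := Nat.exists_eq_succ_of_ne_zero hm
    have h0 : c.zeros (∅ : Set (MvPolynomial (Fin (Fintype.card G.edgeSet)) k)) = 0 := by
      rw [hm']
      exact c.zeros_empty_succ m
    rw [← h0]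
    refine c.zeros_congr fun K _ _ x => ?_
    rw [hpt, Graph.forall_mem_singEqs_iff, hpsi]
    simp

end AffineInvariant

/-- The points of the zero locus of `S` are the points of its coordinate ring. -/
theorem pointCount_eq_card_algHom {σ : Type*} (S : Set (MvPolynomial σ ℤ)) (F : Type*) [Field F] :
    pointCount S F = Nat.card
      (MvPolynomial σ F ⧸ Ideal.span (MvPolynomial.map (Int.castRingHom F) '' S) →ₐ[F] F) := by
  rw [Nat.card_congr (quotientAlgHomEquiv _), pointCount]
  let e : (σ → F) ≃ (MvPolynomial σ F →ₐ[F] F) :=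
    { toFun := fun x => MvPolynomial.aeval x
      invFun := fun φ i => φ (MvPolynomial.X i)
      left_inv := fun x => by ext; simp
      right_inv := fun φ => MvPolynomial.algHom_ext fun i => by simp }
  refine Nat.card_congr (Equiv.subtypeEquiv e fun x => ?_)
  have h : (∀ a ∈ Ideal.span (MvPolynomial.map (Int.castRingHom F) '' S), e x a = 0) ↔
      ∀ f ∈ S, e x (MvPolynomial.map (Int.castRingHom F) f) = 0 := by
    rw [← Set.forall_mem_image (p := fun g => e x g = 0)]
    exact Ideal.span_le (I := RingHom.ker (e x))
  rw [h]
  refine forall₂_congr fun f _ => ?_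
  rw [show e x = MvPolynomial.aeval x from rfl, MvPolynomial.aeval_def, MvPolynomial.aeval_def,
    MvPolynomial.eval₂_map,
    show (algebraMap F F).comp (Int.castRingHom F) = algebraMap ℤ F from RingHom.ext_int _ _]

theorem theorem4p1 {α : Type*} {β : Type} (G : Graph α β) [Fintype G.edgeSet]
    (hV : G.vertexSet.Finite) (hV3 : 3 ≤ G.vertexSet.ncard) (hE : G.edgeSet.Nonempty) :
    (∀ (k : Type u) [Field k], lefschetz k ∣ (zeroScheme G.singEqs k).toK0) ∧
    (∀ q : ℕ, IsPrimePow q → ∀ (F : Type v) [Field F], Nat.card F = q →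
      pointCount G.singEqs F ≡ 0 [MOD q]) := by
  refine ⟨fun k _ => ?_, fun q hq F _ hF => ?_⟩
  · have h := (AffineInvariant.k0 k).cls_singEqs_eq_zero G hV hV3 hE
    exact Ideal.mem_span_singleton.mp (Ideal.Quotient.eq_zero_iff_mem.mp h)
  · subst hF
    -- `Nat.card` of an infinite type is `0`, which is not a prime power.
    have : Finite F := Nat.finite_of_card_ne_zero hq.ne_zero
    have h := (AffineInvariant.points F).cls_singEqs_eq_zero G hV hV3 hE
    rw [← ZMod.natCast_eq_natCast_iff, pointCount_eq_card_algHom, Nat.cast_zero]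
    exact h
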